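/- Let $\mathcal G=(I_A,I_B,\{0,1\},\{0,1\},\pi,V)$ be a nonlocal game with finite question sets and binary answers, and let $\mathcal G_{\mathrm{comp}}$ be the compiled game obtained from $\mathcal G$ and a correct, CPA-secure quantum homomorphic encryption scheme $(\mathrm{Gen},\mathrm{Enc},\mathrm{Eval},\mathrm{Dec})$ with security parameter $\lambda$ (security against uniform QPT adversaries, where QPT means logspace-uniform families of polynomial-size quantum circuits). Let $S=(|\psi\rangle,\{A_{c\alpha}\},\{B_{yb}\})$ be a quantum strategy for $\mathcal G_{\mathrm{comp}}$: for each $\lambda$, $|\psi\rangle$ is a QPT-preparable state on a register of qubits, $A_{c\alpha}=U_{c\alpha}P_{c\alpha}$ with $U_{c\alpha}$ a QPT-implementable unitary and $\{P_{c\alpha}\}_\alpha$ a QPT-measurable PVM, and $\{B_{yb}\}_{b\in\{0,1\}}$ is a QPT-measurable PVM for every $y\in I_B$. Write $B_y=B_{y0}-B_{y1}$. Write $\mathbb E_{c\leftarrow \mathrm{Enc}(x)}$ for the expectation over $\mathrm{sk}\leftarrow\mathrm{Gen}(1^\lambda)$ and $c\leftarrow\mathrm{Enc}(\mathrm{sk},x)$,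 and $\mathrm{Dec}(\alpha)=\mathrm{Dec}(\mathrm{sk},\alpha)\in\{0,1\}$. The bias of $S$ is $\beta_q(S,\mathcal G_{\mathrm{comp}})=2\,\omega_q(S,\mathcal G_{\mathrm{comp}})-1$, where $$\omega_q(S,\mathcal G_{\mathrm{comp}})=\sum_{x,y}\pi(x,y)\sum_{a,b}V(x,y,a,b)\,\mathbb E_{c\leftarrow \mathrm{Enc}(x)}\sum_{\alpha:\mathrm{Dec}(\alpha)=a}\langle\psi|A_{c\alpha}^*B_{yb}A_{c\alpha}|\psi\rangle .$$ Let $\mathcal A=\mathbb C[\mathbb Z_2^{*I_A}\times\mathbb Z_2^{*I_B}]$ with canonical generators $a_x$ ($x\in I_A$) and $b_y$ ($y\in I_B$), and let $$h_{\mathcal G}=2\sum_{x,y}\pi(x,y)\sum_{a,b}V(x,y,a,b)\,\frac{1+(-1)^a a_x}{2}\cdot\frac{1+(-1)^b b_y}{2}-1$$ be the bias polynomial (for an XOR game, $h_{\mathcal G}=\sum_{x,y}\pi(x,y)(-1)^{g(x,y)}a_xb_y$). Let $\mu$ be a probability distribution on $I_A$ (for instance the uniform one). The degree-2 pseudo-expectation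 $\tilde{\mathbb E}_S$ induced by $S$ is the linear functional, defined for each $\lambda$ on the span of the monomials of degree 2 in $\mathcal A$ (which contains $1=a_x^2=b_y^2$), with $\tilde{\mathbb E}_S[1]=1$, $\tilde{\mathbb E}_S[a_xa_z]=\delta_{xz}$ and $$\tilde{\mathbb E}_S[a_xb_y]=\tilde{\mathbb E}_S[b_ya_x]=\mathbb E_{c\leftarrow\mathrm{Enc}(x)}\sum_\alpha(-1)^{\mathrm{Dec}(\alpha)}\langle\psi|A_{c\alpha}^*B_yA_{c\alpha}|\psi\rangle,\qquad \tilde{\mathbb E}_S[b_yb_w]=\mathbb E_{x\leftarrow\mu}\mathbb E_{c\leftarrow\mathrm{Enc}(x)}\sum_\alpha\langle\psi|A_{c\alpha}^*B_yB_wA_{c\alpha}|\psi\rangle .$$ Then: 1. For all real $(\gamma_y)_{y\in I_B}$ and all $\lambda$, $\ \tilde{\mathbb E}_S\big[(\sum_y\gamma_yb_y)^2\big]\ge 0$. 2. For all real $(\gamma_{xy})_{x\in I_A,y\in I_B}$ there is a negligible function $\eta$ (which may depend on $S$) such that for all $\lambda$ and all $x\in I_A$, $\ \tilde{\mathbb E}_S\big[(a_x-\sum_y\gamma_{xy}b_y)^2\big]\ge-\eta(\lambda)$.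 3. Let $\beta\in\mathbb R$ and suppose that $\beta\cdot 1-h_{\mathcal G}$ has a nice sum-of-squares decomposition, i.e. is equal in $\mathcal A$ to a finite non-negative linear combination of elements of the forms $(\sum_y\gamma_yb_y)^2$ and $(a_x-\sum_y\gamma_yb_y)^2$ with real coefficients $\gamma_y$. Then there is a negligible function $\eta$ (which may depend on $S$) such that $\beta_q(S,\mathcal G_{\mathrm{comp}})\le\beta+\eta(\lambda)$ for all $\lambda$. -/

import Mathlib

open scoped Matrix Kronecker ComplexOrder

noncomputable section

namespace CompiledGames

/-! ### Logarithmic space -/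

/-- Programs for a machine with finitely many registers, each holding a natural number:
increment, decrement (truncated at zero), sequencing, and `while r ≠ 0 do P`. -/
inductive Prog
  | inc (r : ℕ)
  | dec (r : ℕ)
  | seq (P Q : Prog)
  | loop (r : ℕ) (P : Prog)

/-- `Runs M P s t`: started with register contents `s`, the program `P` halts with register
contents `t`, and no increment on the way makes a register exceed `M`. -/
inductive Prog.Runs (M : ℕ) : Prog → (ℕ → ℕ) → (ℕ → ℕ) → Prop
  | inc (r : ℕ) (s : ℕ → ℕ) (h : s r + 1 ≤ M) :
      Prog.Runs M (.inc r) s (Function.update s r (s r + 1))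
  | dec (r : ℕ) (s : ℕ → ℕ) : Prog.Runs M (.dec r) s (Function.update s r (s r - 1))
  | seq {P Q : Prog} {s t u : ℕ → ℕ} (hP : Prog.Runs M P s t) (hQ : Prog.Runs M Q t u) :
      Prog.Runs M (.seq P Q) s u
  | loop_done {r : ℕ} {P : Prog} {s : ℕ → ℕ} (h : s r = 0) : Prog.Runs M (.loop r P) s s
  | loop_step {r : ℕ} {P : Prog} {s t u : ℕ → ℕ} (h : s r ≠ 0) (hP : Prog.Runs M P s t)
      (hL : Prog.Runs M (.loop r P) t u) : Prog.Runs M (.loop r P) s u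

/-- Initial registers: the two inputs in registers `0` and `1`, all others empty. -/
def Prog.input (k i : ℕ) : ℕ → ℕ := fun r => if r = 0 then k else if r = 1 then i else 0

/-- `f` is computable in logarithmic space from the security parameter `k` and an index `i`, both
given in unary: a program with a constant number of registers computes it (result in register
`0`), and every register stays bounded by a polynomial in `k + i`, that is, its binary expansion
has `O(log (k + i))` bits. -/
def LogspaceComputable₂ (f : ℕ → ℕ → ℕ) : Prop :=
  ∃ (P : Prog) (d : ℕ), ∀ k i : ℕ, ∃ t : ℕ → ℕ,
    P.Runs ((k + i + 2) ^ d) (Prog.input k i) t ∧ t 0 = f k i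

/-- Logspace computability of a function of the security parameter (in unary). In particular
the values are polynomially bounded. -/
def LogspaceComputable (f : ℕ → ℕ) : Prop := LogspaceComputable₂ fun k _ => f k

/-- A family of circuit descriptions (lists of gate codes, a gate code being a gate kind followed
by up to three wire numbers) is logspace uniform if its length, and the entries of its `i`-th gate
code, are computable in logarithmic space. In particular the length is polynomial in `k`. -/
def LogspaceUniform (desc : ℕ → List (Fin 4 → ℕ)) : Prop :=
  LogspaceComputable (fun k => (desc k).length) ∧
    ∀ j : Fin 4, LogspaceComputable₂ fun k i => (desc k).getD i (fun _ => 0) j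

/-! ### Bit strings, gates and circuits -/

/-- Bit strings of length `w`. -/
abbrev Bits (w : ℕ) : Type := Fin w → Bool

/-- The `i`-th bit, or `0` beyond the end. -/
def Bits.bit {w : ℕ} (z : Bits w) (i : ℕ) : Bool := if h : i < w then z ⟨i, h⟩ else false

/-- The first `m` bits, padded with zeros if `m` exceeds the length. -/
def Bits.resize {w : ℕ} (m : ℕ) (z : Bits w) : Bits m := fun i => z.bit i

/-- The block of `m` bits starting at position `i`. -/
def Bits.slice {w : ℕ} (i m : ℕ) (z : Bits w) : Bits m := fun t => z.bit (i + t)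

/-- Xor the string `c` into the block of `z` that starts at position `j`. -/
def Bits.xorAt {w l : ℕ} (j : ℕ) (c : Bits l) (z : Bits w) : Bits w :=
  fun t => if j ≤ t.val then xor (z t) (c.bit (t.val - j)) else z t

/-- Classical reversible gates on `w` wires: NOT, CNOT and Toffoli. -/
inductive CGate (w : ℕ)
  | x (i : Fin w)
  | cnot (i j : Fin w) (h : i ≠ j)
  | ccnot (i j l : Fin w) (hij : i ≠ j) (hil : i ≠ l) (hjl : j ≠ l)

/-- Action on basis states; the last wire listed is the target. -/
def CGate.act {w : ℕ} : CGate w → Bits w → Bits w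
  | .x i, z => Function.update z i (!(z i))
  | .cnot i j _, z => Function.update z j (xor (z j) (z i))
  | .ccnot i j l _ _ _, z => Function.update z l (xor (z l) (z i && z j))

def CGate.code {w : ℕ} : CGate w → Fin 4 → ℕ
  | .x i => ![1, i, 0, 0]
  | .cnot i j _ => ![2, i, j, 0]
  | .ccnot i j l _ _ _ => ![3, i, j, l]

/-- Quantum gates on `w` qubits: the classical reversible gates, the Hadamard gate, and the gate
`T = diag(1, exp(iπ/4))` with its inverse. -/
inductive Gate (w : ℕ)
  | cl (g : CGate w)
  | had (i : Fin w)
  | tee (i : Fin w)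
  | teeInv (i : Fin w)

/-- The unitary matrix of a gate in the computational basis. -/
def Gate.mat {w : ℕ} : Gate w → Matrix (Bits w) (Bits w) ℂ
  | .cl g => Matrix.of fun z' z => if z' = g.act z then 1 else 0
  | .had i => Matrix.of fun z' z =>
      if ∀ j, j ≠ i → z' j = z j then
        (if z' i && z i then -1 else 1) * (1 / (Real.sqrt 2 : ℂ))
      else 0
  | .tee i => Matrix.diagonal fun z =>
      if z i then Complex.exp (Complex.I * (Real.pi / 4)) else 1
  | .teeInv i => Matrix.diagonal fun z =>
      if z i then Complex.exp (-(Complex.I * (Real.pi / 4))) else 1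

def Gate.code {w : ℕ} : Gate w → Fin 4 → ℕ
  | .cl g => g.code
  | .had i => ![4, i, 0, 0]
  | .tee i => ![5, i, 0, 0]
  | .teeInv i => ![6, i, 0, 0]

/-- A quantum circuit on `w` qubits, first gate first. -/
abbrev Circuit (w : ℕ) : Type := List (Gate w)

def Circuit.mat {w : ℕ} : Circuit w → Matrix (Bits w) (Bits w) ℂ
  | [] => 1
  | g :: C => Circuit.mat C * g.mat

/-- The isometry `|φ⟩ ↦ |φ⟩ |v⟩ |0…0⟩` that loads an `h`-qubit register into the first `h` of `w`
wires, the classical string `v` into the next `l` wires, and zeros into the remaining ones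
(used for `h + l ≤ w`). -/
def load (w h : ℕ) {l : ℕ} (v : Bits l) : Matrix (Bits w) (Bits h) ℂ :=
  Matrix.of fun z u => if z = Bits.resize w (Fin.append u v) then 1 else 0

/-- The projection onto the basis states whose first `m` wires read `α`. -/
def readout (w : ℕ) {m : ℕ} (α : Bits m) : Matrix (Bits w) (Bits w) ℂ :=
  Matrix.diagonal fun z => if z.resize m = α then 1 else 0

/-- The POVM element on an `h`-qubit register of: adjoin the classical input `v` and zeroed
ancillas, run `C`, measure the first `m` wires, and obtain `α`. -/
def Circuit.effect {w : ℕ} (C : Circuit w) (h : ℕ) {l m : ℕ} (v : Bits l) (α : Bits m) :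
    Matrix (Bits h) (Bits h) ℂ :=
  (load w h v)ᴴ * C.matᴴ * readout w α * C.mat * load w h v

/-- A QPT algorithm: a logspace-uniform family of quantum circuits (of polynomial size) indexed by
the security parameter. -/
structure QPTFamily where
  width : ℕ → ℕ
  circuit : ∀ k, Circuit (width k)
  width_logspace : LogspaceComputable width
  uniform : LogspaceUniform fun k => (circuit k).map Gate.code

/-! ### QPT states, unitaries and measurements -/

/-- The family of states `ψ` is efficiently preparable. -/
def QPTPreparable {h : ℕ → ℕ} (ψ : ∀ k, Bits (h k) → ℂ) : Prop :=
  ∃ C : QPTFamily, ∀ k, h k ≤ C.width k ∧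
    (C.circuit k).mat *ᵥ Pi.single (fun _ => false) 1 =
      load (C.width k) (h k) (Fin.elim0 : Bits 0) *ᵥ ψ k

/-- The measurements `M k v`, depending on a classical input `v` from the set `D k`, with outcomes
in `Bits (m k)`, are QPT-measurable: one QPT circuit, given `v` in an input register, yields the
same outcome probabilities on every state. (Efficient classical post-processing of the outcome is
part of the circuit.) -/
def QPTMeasurable {h l m : ℕ → ℕ} (D : ∀ k, Set (Bits (l k)))
    (M : ∀ k, Bits (l k) → Bits (m k) → Matrix (Bits (h k)) (Bits (h k)) ℂ) : Prop :=
  ∃ C : QPTFamily, ∀ k, h k + l k ≤ C.width k ∧ m k ≤ C.width k ∧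
    ∀ v ∈ D k, ∀ α : Bits (m k), (C.circuit k).effect (h k) v α = M k v α

/-- The unitaries `U k v`, depending on a classical input `v` from the set `D k`, are implemented
by one QPT circuit that is given `v` in an input register and returns its ancillas to zero. -/
def QPTImplementable {h l : ℕ → ℕ} (D : ∀ k, Set (Bits (l k)))
    (U : ∀ k, Bits (l k) → Matrix (Bits (h k)) (Bits (h k)) ℂ) : Prop :=
  ∃ C : QPTFamily, ∀ k, h k + l k ≤ C.width k ∧
    ∀ v ∈ D k, (C.circuit k).mat * load (C.width k) (h k) v =
      load (C.width k) (h k) v * U k v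

/-- Projection-valued measures with outcomes in a finite set. -/
structure IsPVM {ι o : Type*} [Fintype ι] [DecidableEq ι] [Fintype o]
    (P : o → Matrix ι ι ℂ) : Prop where
  isStarProjection : ∀ α, IsStarProjection (P α)
  orthogonal : ∀ α α', α ≠ α' → P α * P α' = 0
  sum_eq_one : ∑ α, P α = 1

/-! ### Probabilistic polynomial time and homomorphic encryption -/

/-- A PPT algorithm with inputs of length `inLen k` and outputs of length `outLen k`: a
logspace-uniform family of classical circuits with uniformly random coins. -/
structure PPT (inLen outLen : ℕ → ℕ) where
  coins : ℕ → ℕ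
  width : ℕ → ℕ
  circuit : ∀ k, List (CGate (width k))
  coins_logspace : LogspaceComputable coins
  width_logspace : LogspaceComputable width
  uniform : LogspaceUniform fun k => (circuit k).map CGate.code
  in_le : ∀ k, inLen k + coins k ≤ width k
  out_le : ∀ k, outLen k ≤ width k

/-- The output on input `x` with coins `r`. -/
def PPT.output {inLen outLen : ℕ → ℕ} (A : PPT inLen outLen) (k : ℕ) (x : Bits (inLen k))
    (r : Bits (A.coins k)) : Bits (outLen k) :=
  Bits.resize (outLen k)
    ((A.circuit k).foldl (fun z g => g.act z) (Bits.resize (A.width k) (Fin.append x r)))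

/-- The probability of the output `y` on input `x`. -/
def PPT.prob {inLen outLen : ℕ → ℕ} (A : PPT inLen outLen) (k : ℕ) (x : Bits (inLen k))
    (y : Bits (outLen k)) : ℝ :=
  (∑ r : Bits (A.coins k), if A.output k x r = y then 1 else 0) / 2 ^ A.coins k

def Negligible (η : ℕ → ℝ) : Prop :=
  Asymptotics.SuperpolynomialDecay Filter.atTop (fun k : ℕ => (k : ℝ)) η

/-- The algorithms of a quantum homomorphic encryption scheme for `n`-bit classical messages and
quantum circuits with an auxiliary quantum input and a one-bit classical output.
`eval C` is a QPT algorithm that receives the auxiliary register of `a` qubits and a ciphertext and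
outputs an evaluated (classical) ciphertext of length `evalLen C`. Decryption is deterministic on
classical ciphertexts, which may have any length. -/
structure QHE (n : ℕ) where
  keyLen : ℕ → ℕ
  ciphLen : ℕ → ℕ
  keyLen_logspace : LogspaceComputable keyLen
  ciphLen_logspace : LogspaceComputable ciphLen
  gen : PPT (fun _ => 0) keyLen
  enc : PPT (fun k => keyLen k + n) ciphLen
  dec : ∀ k, Bits (keyLen k) → List Bool → Bool
  dec_qpt : ∀ m : ℕ → ℕ, LogspaceComputable m → ∃ C : QPTFamily, ∀ k,
    keyLen k + m k ≤ C.width k ∧ 1 ≤ C.width k ∧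
      ∀ (sk : Bits (keyLen k)) (α : Bits (m k)),
        (C.circuit k).effect 0 (Fin.append sk α) (fun _ : Fin 1 => dec k sk (List.ofFn α)) = 1
  evalLen : ∀ {w : ℕ}, Circuit w → ℕ → ℕ → ℕ
  evalLen_logspace : ∀ {w : ℕ} (C : Circuit w) (a : ℕ), LogspaceComputable (evalLen C a)
  eval : ∀ {w : ℕ}, Circuit w → ℕ → QPTFamily
  eval_le : ∀ {w : ℕ} (C : Circuit w) (a k : ℕ),
    a + ciphLen k ≤ (eval C a).width k ∧ evalLen C a k ≤ (eval C a).width k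

namespace QHE

variable {n : ℕ}

/-- The probability that `Gen` outputs the key `sk`. -/
def genProb (Q : QHE n) (k : ℕ) (sk : Bits (Q.keyLen k)) : ℝ := Q.gen.prob k Fin.elim0 sk

/-- The probability that `Enc(sk, x)` outputs the ciphertext `c`. -/
def encProb (Q : QHE n) (k : ℕ) (sk : Bits (Q.keyLen k)) (x : Bits n) (c : Bits (Q.ciphLen k)) :
    ℝ := Q.enc.prob k (Fin.append sk x) c

/-- The POVM element on the auxiliary register for the outcome `b` when the message `x` is
encrypted under a fresh key, `C` is evaluated homomorphically, and the result is decrypted. -/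
def evalEffect (Q : QHE n) {w : ℕ} (C : Circuit w) (a k : ℕ) (x : Bits n) (b : Bool) :
    Matrix (Bits a) (Bits a) ℂ :=
  ∑ sk : Bits (Q.keyLen k), (Q.genProb k sk : ℂ) •
    ∑ c : Bits (Q.ciphLen k), (Q.encProb k sk x c : ℂ) •
      ∑ α : Bits (Q.evalLen C a k),
        if Q.dec k sk (List.ofFn α) = b then ((Q.eval C a).circuit k).effect a c α else 0

/-- Correctness with auxiliary input: for every circuit `C` and message `x`, and every state `ψ` of
the auxiliary register together with a reference register of any size, running `C` and running the
homomorphic evaluation lead to outcome bit and reference register in states of negligible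
trace distance. The trace distance is the largest difference of acceptance probabilities over all
tests `E` of outcome and reference register. -/
def Correct (Q : QHE n) : Prop :=
  ∀ (w a : ℕ) (C : Circuit w), a + n ≤ w → 1 ≤ w → ∀ x : Bits n,
    ∃ η : ℕ → ℝ, Negligible η ∧
      ∀ (k b : ℕ) (ψ : Bits a × Bits b → ℂ), star ψ ⬝ᵥ ψ = 1 →
        ∀ E : Bool → Matrix (Bits b) (Bits b) ℂ,
          (∀ o, (E o).PosSemidef ∧ (1 - E o).PosSemidef) →
            ‖star ψ ⬝ᵥ ((∑ o, (C.effect a x (fun _ : Fin 1 => o) - Q.evalEffect C a k x o) ⊗ₖ E o)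
              *ᵥ ψ)‖ ≤ η k

/-- Instructions of an oracle circuit on `w` wires: quantum gates, and `query i j`, which measures
the `n` wires from position `i`, sends the result `x` to the encryption oracle, and xors the
fresh ciphertext into the `l` wires from position `j`. -/
inductive OGate (n l w : ℕ)
  | gate (g : Gate w)
  | query (i j : ℕ) (hi : i + n ≤ w) (hj : j + l ≤ w)

def OGate.code {l w : ℕ} : OGate n l w → Fin 4 → ℕ
  | .gate g => g.code
  | .query i j _ _ => ![7, i, j, 0]

/-- The action of an instruction on density matrices; `p x c` is the probability that the oracle
answers the query `x` by `c`. -/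
def OGate.step {l w : ℕ} (p : Bits n → Bits l → ℝ) :
    OGate n l w → Matrix (Bits w) (Bits w) ℂ → Matrix (Bits w) (Bits w) ℂ
  | .gate g, ρ => g.mat * ρ * g.matᴴ
  | .query i j _ _, ρ => ∑ x : Bits n, ∑ c : Bits l,
      let K : Matrix (Bits w) (Bits w) ℂ :=
        Matrix.of fun z' z => if z.slice i n = x ∧ z' = Bits.xorAt j c z then 1 else 0
      (p x c : ℂ) • (K * ρ * Kᴴ)

/-- A QPT adversary with access to an encryption oracle. -/
structure Adversary (Q : QHE n) where
  width : ℕ → ℕ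
  circuit : ∀ k, List (OGate n (Q.ciphLen k) (width k))
  width_logspace : LogspaceComputable width
  uniform : LogspaceUniform fun k => (circuit k).map OGate.code
  in_le : ∀ k, Q.ciphLen k ≤ width k
  out_le : ∀ k, 1 ≤ width k

/-- The probability that the adversary, given the challenge `c` (on its first wires) and the oracle
`Enc(sk, ·)`, outputs `1` (on its first wire). -/
def Adversary.accept {Q : QHE n} (A : Q.Adversary) (k : ℕ) (sk : Bits (Q.keyLen k))
    (c : Bits (Q.ciphLen k)) : ℝ :=
  let start : Bits (A.width k) := c.resize (A.width k)
  let final := (A.circuit k).foldl (fun ρ g => g.step (Q.encProb k sk) ρ)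
    (Matrix.single start start (1 : ℂ))
  (∑ z : Bits (A.width k), if z.bit 0 then final z z else 0).re

/-- The acceptance probability when the challenge is an encryption of `x`. -/
def Adversary.winProb {Q : QHE n} (A : Q.Adversary) (k : ℕ) (x : Bits n) : ℝ :=
  ∑ sk : Bits (Q.keyLen k), Q.genProb k sk *
    ∑ c : Bits (Q.ciphLen k), Q.encProb k sk x c * A.accept k sk c

/-- CPA security against (uniform) QPT adversaries. -/
def CPASecure (Q : QHE n) : Prop :=
  ∀ (A : Q.Adversary) (x₀ x₁ : Bits n), Negligible fun k => |A.winProb k x₀ - A.winProb k x₁|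

end QHE

/-! ### Games and the scenario algebra -/

/-- A nonlocal game with finite question sets and answers in `{0, 1}`. -/
structure Game (IA IB : Type*) [Fintype IA] [Fintype IB] where
  π : IA → IB → ℝ
  π_nonneg : ∀ x y, 0 ≤ π x y
  π_sum : ∑ x, ∑ y, π x y = 1
  V : IA → IB → Bool → Bool → Bool

/-- The free product of copies of `ℤ/2` indexed by `ι`. -/
abbrev FreeZ2 (ι : Type*) : Type _ := Monoid.CoprodI fun _ : ι => Multiplicative (ZMod 2)

def FreeZ2.gen {ι : Type*} (i : ι) : FreeZ2 ι :=
  Monoid.CoprodI.of (M := fun _ : ι => Multiplicative (ZMod 2)) (i := i) (Multiplicative.ofAdd 1)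

/-- The scenario algebra `ℂ[ℤ₂^{*IA} × ℤ₂^{*IB}]`. -/
abbrev ScenarioAlgebra (IA IB : Type*) : Type _ := MonoidAlgebra ℂ (FreeZ2 IA × FreeZ2 IB)

section Scenario

variable {IA IB : Type*}

/-- The abstract observable of Alice for the question `x`. -/
def obsA (x : IA) : ScenarioAlgebra IA IB := MonoidAlgebra.of ℂ _ (FreeZ2.gen x, 1)

/-- The abstract observable of Bob for the question `y`. -/
def obsB (y : IB) : ScenarioAlgebra IA IB := MonoidAlgebra.of ℂ _ (1, FreeZ2.gen y)

/-- `(-1)^a` -/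
def sgn (a : Bool) : ℂ := if a then -1 else 1

/-- The abstract spectral projections `(1 + (-1)^a a_x) / 2`. -/
def projA (x : IA) (a : Bool) : ScenarioAlgebra IA IB := (1 / 2 : ℂ) • (1 + sgn a • obsA x)

def projB (y : IB) (b : Bool) : ScenarioAlgebra IA IB := (1 / 2 : ℂ) • (1 + sgn b • obsB y)

variable [Fintype IA] [Fintype IB]

/-- The game polynomial `p_G`. -/
def Game.poly (G : Game IA IB) : ScenarioAlgebra IA IB :=
  ∑ x, ∑ y, (G.π x y : ℂ) • ∑ a, ∑ b, if G.V x y a b then projA x a * projB y b else 0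

/-- The bias polynomial `h_G = 2 p_G - 1`. -/
def Game.biasPoly (G : Game IA IB) : ScenarioAlgebra IA IB := (2 : ℂ) • G.poly - 1

/-- For an XOR game with predicate `a + b = g(x, y)` the bias polynomial is
`∑ π(x, y) (-1)^{g(x, y)} a_x b_y`. -/
theorem Game.biasPoly_xor (G : Game IA IB) (g : IA → IB → Bool)
    (hV : ∀ x y a b, G.V x y a b = (xor a b == g x y)) :
    G.biasPoly = ∑ x, ∑ y, ((G.π x y : ℂ) * sgn (g x y)) • (obsA x * obsB y) := by
  have h1 : (1 : ScenarioAlgebra IA IB) = ∑ x, ∑ y, (G.π x y : ℂ) • 1 := by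
    simp_rw [← Finset.sum_smul]
    have : (∑ x, ∑ y, (G.π x y : ℂ)) = 1 := by exact_mod_cast G.π_sum
    rw [this, one_smul]
  rw [Game.biasPoly, Game.poly]
  conv_lhs => rw [h1]
  simp_rw [Finset.smul_sum, ← Finset.sum_sub_distrib]
  refine Finset.sum_congr rfl fun x _ => Finset.sum_congr rfl fun y _ => ?_
  simp only [hV, Fintype.sum_bool, projA, projB, sgn]
  cases g x y <;> simp [mul_add, add_mul, smul_add] <;> module

/-- The squares `(∑ γ_y b_y)²` and `(a_x - ∑ γ_y b_y)²`. -/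
inductive IsNiceSquare : ScenarioAlgebra IA IB → Prop
  | bob (γ : IB → ℝ) : IsNiceSquare ((∑ y, (γ y : ℂ) • obsB y) ^ 2)
  | alice (x : IA) (γ : IB → ℝ) : IsNiceSquare ((obsA x - ∑ y, (γ y : ℂ) • obsB y) ^ 2)

/-- `p` has a nice sum-of-squares decomposition. -/
def HasNiceSOS (p : ScenarioAlgebra IA IB) : Prop :=
  ∃ (N : ℕ) (c : Fin N → ℝ) (q : Fin N → ScenarioAlgebra IA IB),
    (∀ i, 0 ≤ c i ∧ IsNiceSquare (q i)) ∧ p = ∑ i, (c i : ℂ) • q i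

end Scenario

/-! ### Compiled games -/

/-- A compiled game: a game, the algorithms of a QHE scheme, and an encoding of the questions of
Alice as messages. -/
structure CompiledGame (IA IB : Type*) [Fintype IA] [Fintype IB] (n : ℕ) where
  game : Game IA IB
  qhe : QHE n
  encode : IA ↪ Bits n

section Compiled

variable {IA IB : Type*} [Fintype IA] [Fintype IB] {n : ℕ}

/-- The ciphertexts that the verifier may send. -/
def CompiledGame.challenges (G : CompiledGame IA IB n) (k : ℕ) : Set (Bits (G.qhe.ciphLen k)) :=
  {c | ∃ sk x, 0 < G.qhe.genProb k sk ∧ 0 < G.qhe.encProb k sk (G.encode x) c}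

/-- A quantum strategy for a compiled game. The Hilbert space consists of `dim k` qubits, and the
replies of the prover in the first round are strings of length `ansLen k`. The operators
`A_{cα}` are `U_{cα} P_{cα}`. -/
structure Strategy (G : CompiledGame IA IB n) where
  dim : ℕ → ℕ
  ansLen : ℕ → ℕ
  dim_logspace : LogspaceComputable dim
  ansLen_logspace : LogspaceComputable ansLen
  ψ : ∀ k, Bits (dim k) → ℂ
  U : ∀ k, Bits (G.qhe.ciphLen k) → Bits (ansLen k) → Matrix (Bits (dim k)) (Bits (dim k)) ℂ
  P : ∀ k, Bits (G.qhe.ciphLen k) → Bits (ansLen k) → Matrix (Bits (dim k)) (Bits (dim k)) ℂ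
  B : ∀ k, IB → Bool → Matrix (Bits (dim k)) (Bits (dim k)) ℂ
  ψ_norm : ∀ k, star (ψ k) ⬝ᵥ ψ k = 1
  U_unitary : ∀ k, ∀ c ∈ G.challenges k, ∀ α, U k c α ∈ Matrix.unitaryGroup (Bits (dim k)) ℂ
  P_pvm : ∀ k, ∀ c ∈ G.challenges k, IsPVM (P k c)
  B_pvm : ∀ k y, IsPVM (B k y)
  ψ_qpt : QPTPreparable ψ
  U_qpt : QPTImplementable (l := fun k => G.qhe.ciphLen k + ansLen k)
    (fun k => {v | ∃ c ∈ G.challenges k, ∃ α, v = Fin.append c α})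
    (fun k v => U k (fun i => v (Fin.castAdd (ansLen k) i))
      (fun i => v (Fin.natAdd (G.qhe.ciphLen k) i)))
  P_qpt : QPTMeasurable G.challenges P
  B_qpt : ∀ y, QPTMeasurable (l := fun _ => 0) (m := fun _ => 1) (fun _ => Set.univ)
    (fun k _ b => B k y (b 0))

namespace Strategy

variable {G : CompiledGame IA IB n}

/-- The unnormalized post-measurement state `A_{cα} |ψ⟩`. -/
def post (S : Strategy G) (k : ℕ) (c : Bits (G.qhe.ciphLen k)) (α : Bits (S.ansLen k)) :
    Bits (S.dim k) → ℂ := (S.U k c α * S.P k c α) *ᵥ S.ψ k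

/-- `E_{c ← Enc(x)} ∑_α f(Dec α) ⟨ψ| A_{cα}^* M A_{cα} |ψ⟩` -/
def expect (S : Strategy G) (k : ℕ) (x : IA) (f : Bool → ℂ)
    (M : Matrix (Bits (S.dim k)) (Bits (S.dim k)) ℂ) : ℂ :=
  ∑ sk, (G.qhe.genProb k sk : ℂ) * ∑ c, (G.qhe.encProb k sk (G.encode x) c : ℂ) *
    ∑ α : Bits (S.ansLen k), f (G.qhe.dec k sk (List.ofFn α)) *
      (star (S.post k c α) ⬝ᵥ (M *ᵥ S.post k c α))

/-- The probability `p(a, b | x, y)`. -/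
def prob (S : Strategy G) (k : ℕ) (a b : Bool) (x : IA) (y : IB) : ℝ :=
  (S.expect k x (fun a' => if a' = a then 1 else 0) (S.B k y b)).re

/-- The winning probability in the compiled game with security parameter `k`. -/
def winProb (S : Strategy G) (k : ℕ) : ℝ :=
  ∑ x, ∑ y, G.game.π x y * ∑ a, ∑ b, if G.game.V x y a b then S.prob k a b x y else 0

/-- The bias. -/
def bias (S : Strategy G) (k : ℕ) : ℝ := 2 * S.winProb k - 1

/-- The binary observable `B_y = B_{y0} - B_{y1}`. -/
def obs (S : Strategy G) (k : ℕ) (y : IB) : Matrix (Bits (S.dim k)) (Bits (S.dim k)) ℂ :=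
  S.B k y false - S.B k y true

/-- The value of the pseudo-expectation on the monomials `a_x b_y = b_y a_x`. -/
def corrAB (S : Strategy G) (k : ℕ) (x : IA) (y : IB) : ℂ := S.expect k x sgn (S.obs k y)

/-- The value of the pseudo-expectation on the monomials `b_y b_w`; `μ` is the distribution of the
question `x`. -/
def corrBB (S : Strategy G) (μ : IA → ℝ) (k : ℕ) (y w : IB) : ℂ :=
  ∑ x, (μ x : ℂ) * S.expect k x (fun _ => 1) (S.obs k y * S.obs k w)

end Strategy

open Classical in
/-- The indices of the letters of the reduced word of a group element. -/
def FreeZ2.letters {ι : Type*} (g : FreeZ2 ι) : List ι :=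
  (Monoid.CoprodI.Word.equiv g).toList.map Sigma.fst

/-- The pseudo-expectation on reduced words. It is meant for the words `1`, `a_x a_z`, `a_x b_y` and
`b_y b_w`, and extended by zero to all others. -/
def Strategy.wordValue {G : CompiledGame IA IB n} (S : Strategy G) (μ : IA → ℝ) (k : ℕ)
    (g : FreeZ2 IA × FreeZ2 IB) : ℂ :=
  match g.1.letters, g.2.letters with
  | [], [] => 1
  | [x], [y] => S.corrAB k x y
  | [], [y, w] => S.corrBB μ k y w
  | _, _ => 0

/-- The degree 2 pseudo-expectation induced by `S` (for the security parameter `k`), as a linear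
functional. -/
def Strategy.pseudoExp {G : CompiledGame IA IB n} (S : Strategy G) (μ : IA → ℝ) (k : ℕ) :
    ScenarioAlgebra IA IB →ₗ[ℂ] ℂ :=
  Finsupp.linearCombination ℂ (S.wordValue μ k) ∘ₗ
    (MonoidAlgebra.coeffLinearEquiv ℂ).toLinearMap

end Compiled

/-! ### The pseudo-expectation takes the intended values -/

theorem FreeZ2.gen_mul_self {ι : Type*} (i : ι) : FreeZ2.gen i * FreeZ2.gen i = 1 := by
  rw [FreeZ2.gen, ← map_mul, ← ofAdd_add]
  have : (1 : ZMod 2) + 1 = 0 := by decide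
  rw [this, ofAdd_zero, map_one]

theorem FreeZ2.letters_one {ι : Type*} : FreeZ2.letters (1 : FreeZ2 ι) = [] := by
  classical
  have h : (1 : FreeZ2 ι) = Monoid.CoprodI.Word.equiv.symm Monoid.CoprodI.Word.empty := rfl
  rw [FreeZ2.letters, h, Equiv.apply_symm_apply]
  rfl

theorem FreeZ2.letters_gen {ι : Type*} (i : ι) : FreeZ2.letters (FreeZ2.gen i) = [i] := by
  classical
  have h1 : (Multiplicative.ofAdd (1 : ZMod 2)) ≠ 1 := by decide
  have h : FreeZ2.gen i = Monoid.CoprodI.Word.equiv.symm (Monoid.CoprodI.Word.cons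
      (M := fun _ : ι => Multiplicative (ZMod 2)) (i := i)
      (Multiplicative.ofAdd 1) Monoid.CoprodI.Word.empty
      (by simp [Monoid.CoprodI.Word.fstIdx, Monoid.CoprodI.Word.empty]) h1) := by
    change _ = Monoid.CoprodI.Word.prod _
    simp [FreeZ2.gen, Monoid.CoprodI.Word.prod, Monoid.CoprodI.Word.cons,
      Monoid.CoprodI.Word.empty]
  rw [FreeZ2.letters, h]
  simp only [Equiv.apply_symm_apply]
  rfl

theorem FreeZ2.letters_gen_mul {ι : Type*} {i j : ι} (hij : i ≠ j) :
    FreeZ2.letters (FreeZ2.gen i * FreeZ2.gen j) = [i, j] := by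
  classical
  have h1 : (Multiplicative.ofAdd (1 : ZMod 2)) ≠ 1 := by decide
  have h : FreeZ2.gen i * FreeZ2.gen j = Monoid.CoprodI.Word.equiv.symm
      (Monoid.CoprodI.Word.cons (M := fun _ : ι => Multiplicative (ZMod 2)) (i := i)
        (Multiplicative.ofAdd 1) (Monoid.CoprodI.Word.cons
          (M := fun _ : ι => Multiplicative (ZMod 2)) (i := j)
          (Multiplicative.ofAdd 1) Monoid.CoprodI.Word.empty
      (by simp [Monoid.CoprodI.Word.fstIdx, Monoid.CoprodI.Word.empty]) h1)
        (by simpa [Monoid.CoprodI.Word.fstIdx, Monoid.CoprodI.Word.cons] using hij.symm) h1) := by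
    change _ = Monoid.CoprodI.Word.prod _
    simp [FreeZ2.gen, Monoid.CoprodI.Word.prod, Monoid.CoprodI.Word.cons,
      Monoid.CoprodI.Word.empty]
  rw [FreeZ2.letters, h]
  simp only [Equiv.apply_symm_apply]
  rfl

section Values

variable {IA IB : Type*} [Fintype IA] [Fintype IB] {n : ℕ} {G : CompiledGame IA IB n}
  (S : Strategy G) (μ : IA → ℝ) (k : ℕ)

theorem Strategy.pseudoExp_of (g : FreeZ2 IA × FreeZ2 IB) :
    S.pseudoExp μ k (MonoidAlgebra.of ℂ _ g) = S.wordValue μ k g := by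
  simp [Strategy.pseudoExp, MonoidAlgebra.of]

theorem Strategy.pseudoExp_one : S.pseudoExp μ k 1 = 1 := by
  rw [← map_one (MonoidAlgebra.of ℂ _), S.pseudoExp_of]
  simp [Strategy.wordValue, FreeZ2.letters_one]

theorem Strategy.pseudoExp_aa [DecidableEq IA] (x z : IA) :
    S.pseudoExp μ k (obsA x * obsA z) = if x = z then 1 else 0 := by
  rw [obsA, obsA, ← map_mul, S.pseudoExp_of, Prod.mk_mul_mk]
  split_ifs with h
  · subst h
    simp [Strategy.wordValue, FreeZ2.letters_one, FreeZ2.gen_mul_self]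
  · simp [Strategy.wordValue, FreeZ2.letters_one, FreeZ2.letters_gen_mul h]

theorem Strategy.pseudoExp_ab (x : IA) (y : IB) :
    S.pseudoExp μ k (obsA x * obsB y) = S.corrAB k x y := by
  rw [obsA, obsB, ← map_mul, S.pseudoExp_of, Prod.mk_mul_mk]
  simp [Strategy.wordValue, FreeZ2.letters_gen]

theorem Strategy.pseudoExp_ba (x : IA) (y : IB) :
    S.pseudoExp μ k (obsB y * obsA x) = S.corrAB k x y := by
  rw [obsA, obsB, ← map_mul, S.pseudoExp_of, Prod.mk_mul_mk]
  simp [Strategy.wordValue, FreeZ2.letters_gen]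

theorem PPT.sum_prob {inLen outLen : ℕ → ℕ} (A : PPT inLen outLen) (k : ℕ) (x : Bits (inLen k)) :
    ∑ y, A.prob k x y = 1 := by
  simp only [PPT.prob]
  rw [← Finset.sum_div, Finset.sum_comm]
  simp

theorem PPT.prob_nonneg {inLen outLen : ℕ → ℕ} (A : PPT inLen outLen) (k : ℕ)
    (x : Bits (inLen k)) (y : Bits (outLen k)) : 0 ≤ A.prob k x y := by
  unfold PPT.prob
  positivity

theorem IsPVM.sq_sub {ι : Type*} [Fintype ι] [DecidableEq ι] {P : Bool → Matrix ι ι ℂ}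
    (h : IsPVM P) : (P false - P true) * (P false - P true) = 1 := by
  have h1 := (h.isStarProjection false).isIdempotentElem.eq
  have h2 := (h.isStarProjection true).isIdempotentElem.eq
  have h3 := h.orthogonal false true (by decide)
  have h4 := h.orthogonal true false (by decide)
  have h5 := h.sum_eq_one
  simp only [Fintype.sum_bool] at h5
  rw [sub_mul, mul_sub, mul_sub, h1, h2, h3, h4, ← h5]
  abel

theorem Strategy.post_inner {c : Bits (G.qhe.ciphLen k)} (hc : c ∈ G.challenges k)
    (α : Bits (S.ansLen k)) :
    star (S.post k c α) ⬝ᵥ S.post k c α = star (S.ψ k) ⬝ᵥ (S.P k c α *ᵥ S.ψ k) := by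
  have hU := Matrix.mem_unitaryGroup_iff'.1 (S.U_unitary k c hc α)
  have hP := (S.P_pvm k c hc).isStarProjection α
  have h1 : (S.P k c α)ᴴ = S.P k c α := hP.isSelfAdjoint
  have h2 : S.P k c α * S.P k c α = S.P k c α := hP.isIdempotentElem
  rw [Matrix.star_eq_conjTranspose] at hU
  rw [Strategy.post, Matrix.star_mulVec, ← Matrix.dotProduct_mulVec, Matrix.mulVec_mulVec,
    Matrix.conjTranspose_mul, h1, Matrix.mul_assoc, ← Matrix.mul_assoc _ (S.U k c α), hU,
    Matrix.one_mul, h2]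

theorem Strategy.sum_post_inner {c : Bits (G.qhe.ciphLen k)} (hc : c ∈ G.challenges k) :
    ∑ α, star (S.post k c α) ⬝ᵥ S.post k c α = 1 := by
  simp_rw [S.post_inner k hc]
  rw [← dotProduct_sum, ← Matrix.sum_mulVec, (S.P_pvm k c hc).sum_eq_one, Matrix.one_mulVec,
    S.ψ_norm]

theorem Strategy.expect_one (x : IA) : S.expect k x (fun _ => 1) 1 = 1 := by
  have key : ∀ sk c, (G.qhe.genProb k sk : ℂ) * ((G.qhe.encProb k sk (G.encode x) c : ℂ) *
      ∑ α : Bits (S.ansLen k), star (S.post k c α) ⬝ᵥ S.post k c α) =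
      (G.qhe.genProb k sk : ℂ) * (G.qhe.encProb k sk (G.encode x) c : ℂ) := by
    intro sk c
    rcases (PPT.prob_nonneg G.qhe.gen k Fin.elim0 sk).eq_or_lt with h | h
    · simp [QHE.genProb, ← h]
    rcases (PPT.prob_nonneg G.qhe.enc k (Fin.append sk (G.encode x)) c).eq_or_lt with h' | h'
    · simp [QHE.encProb, ← h']
    · rw [S.sum_post_inner k ⟨sk, x, h, h'⟩, mul_one]
  simp only [Strategy.expect, Matrix.one_mulVec, one_mul]
  simp_rw [Finset.mul_sum (s := (Finset.univ : Finset (Bits (G.qhe.ciphLen k)))), key,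
    ← Finset.mul_sum]
  have h1 : ∀ sk, (∑ c, (G.qhe.encProb k sk (G.encode x) c : ℂ)) = 1 := fun sk => by
    exact_mod_cast PPT.sum_prob G.qhe.enc k (Fin.append sk (G.encode x))
  simp_rw [h1, mul_one]
  exact_mod_cast PPT.sum_prob G.qhe.gen k Fin.elim0

theorem Strategy.pseudoExp_bb (hμ : ∑ x, μ x = 1) (y w : IB) :
    S.pseudoExp μ k (obsB y * obsB w) = S.corrBB μ k y w := by
  rw [obsB, obsB, ← map_mul, S.pseudoExp_of, Prod.mk_mul_mk]
  by_cases h : y = w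
  · subst h
    simp only [Strategy.wordValue, one_mul, FreeZ2.letters_one, FreeZ2.gen_mul_self]
    rw [Strategy.corrBB, Strategy.obs, (S.B_pvm k y).sq_sub]
    simp_rw [S.expect_one, mul_one]
    exact_mod_cast hμ.symm
  · simp [Strategy.wordValue, FreeZ2.letters_one, FreeZ2.letters_gen_mul h]

end Values

end CompiledGames

end

open CompiledGames

namespace CompiledGames

/-! ### Register programs -/

/-! Write `T = ∑ γ_y B_y`, and let `v = A_{cα} ψ` be the unnormalized state after the first round.
On `(∑ γ_y b_y)²` the pseudo-expectation is an average of `⟨v, T² v⟩ = ‖T v‖²`, so it is nonnegative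
without any error. If the moments of `b_y b_w` were taken at the encrypted question `x` alone, the
value on `(a_x - ∑ γ_y b_y)²` would be the average of `‖(-1)^{Dec α} v - T v‖²`
(`Strategy.expect_alice_nonneg`). The functional averages these moments over `μ` instead, so it
suffices that the real part of the average of `⟨v, B_y B_w v⟩` varies negligibly with the encrypted
question.

This is where CPA security enters (`Strategy.negligible_moment`). An adversary plays the first round
on its challenge, then measures Bob's observables coherently and xors all outcomes into a single
wire. Branch `o` of that wire carries `(v + (-1)^o X v) / 2`, where `X` is the product of the
observables (`bobGates_mulVec`). As `X` is unitary, the wire reads 1 with probability `(‖v‖² - Re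
⟨v, X v⟩) / 2` (`re_inner_half_sub`). A non-negligible variation of the moment would thus
distinguish two encryptions, even without oracle queries. That the measurements are projective is
essential: it allows the ancillas to be uncomputed after each outcome is copied
(`readout_mul_circuit`).

Security only concerns logspace-uniform families, so the adversary needs an explicit wire layout and
a gate list computable in logarithmic space. This rests on the closure of register programs under
composition (`LogspaceComputable₂.comp`).

For the bias, the polynomial may contain the words `a_x` and `b_y`, which have odd degree. The
functional is extended to them by the marginals of the strategy. Nice squares contain no such words,
so the extension does not affect them (`linearPart_niceSquare`), and it reproduces the bias up to
the variation of the marginals of `B_y`, again negligible (`Strategy.bias_le`). Applying it to the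
sum of squares gives the bound. -/

theorem Prog.Runs.mono {M M' : ℕ} (hM : M ≤ M') {P : Prog} {s t : ℕ → ℕ} (h : P.Runs M s t) :
    P.Runs M' s t := by
  induction h with
  | inc r s h => exact .inc r s (h.trans hM)
  | dec r s => exact .dec r s
  | seq _ _ ih1 ih2 => exact .seq ih1 ih2
  | loop_done h => exact .loop_done h
  | loop_step h _ _ ih1 ih2 => exact .loop_step h ih1 ih2

/-- Only increments are checked against `M`, so a register can exceed `M` only if it did at the
start. This is what bounds computed values polynomially when programs are composed. -/
theorem Prog.Runs.le_max {M : ℕ} {P : Prog} {s t : ℕ → ℕ} (h : P.Runs M s t) (r : ℕ) :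
    t r ≤ max M (s r) := by
  induction h with
  | inc r' s h =>
    by_cases e : r = r'
    · subst e; simp [h]
    · simp [e]
  | dec r' s =>
    by_cases e : r = r'
    · subst e; rw [Function.update_self]; omega
    · simp [e]
  | seq _ _ ih1 ih2 => omega
  | loop_done h => omega
  | loop_step h _ _ ih1 ih2 => omega

/-- A bound on the registers that a program uses. -/
def Prog.regs : Prog → ℕ
  | .inc r => r + 1
  | .dec r => r + 1
  | .seq P Q => max P.regs Q.regs
  | .loop r P => max (r + 1) P.regs

/-- Registers beyond `regs` are never touched, so they are still empty when the next subroutine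
needs them. -/
theorem Prog.Runs.frame {M : ℕ} {P : Prog} {s t : ℕ → ℕ} (h : P.Runs M s t) {r : ℕ}
    (hr : P.regs ≤ r) : t r = s r := by
  induction h with
  | inc r' s h =>
    have : r ≠ r' := by simp only [Prog.regs] at hr; omega
    simp [this]
  | dec r' s =>
    have : r ≠ r' := by simp only [Prog.regs] at hr; omega
    simp [this]
  | seq _ _ ih1 ih2 =>
    simp only [Prog.regs, max_le_iff] at hr
    rw [ih2 hr.2, ih1 hr.1]
  | loop_done h => rfl
  | loop_step h _ _ ih1 ih2 =>
    rw [ih2 hr, ih1]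
    simp only [Prog.regs, max_le_iff] at hr
    exact hr.2

/-- The program with all registers renamed by `r ↦ r + N`. -/
def Prog.shift (N : ℕ) : Prog → Prog
  | .inc r => .inc (r + N)
  | .dec r => .dec (r + N)
  | .seq P Q => .seq (P.shift N) (Q.shift N)
  | .loop r P => .loop (r + N) (P.shift N)

/-- A program can be run as a subroutine in a private block of registers from `N` on, whatever lies
below. -/
theorem Prog.Runs.shift {M : ℕ} (N : ℕ) {P : Prog} {s t : ℕ → ℕ} (h : P.Runs M s t) :
    ∀ s' : ℕ → ℕ, (∀ r, s' (r + N) = s r) → ∃ t', (P.shift N).Runs M s' t' ∧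
      (∀ r, t' (r + N) = t r) ∧ ∀ r < N, t' r = s' r := by
  induction h with
  | inc r s h =>
    intro s' hs
    refine ⟨_, .inc _ _ (by rw [hs]; exact h), fun q => ?_, fun q hq => ?_⟩
    · by_cases e : q = r
      · subst e; simp [hs]
      · simp [e, hs]
    · simp [show q ≠ r + N by omega]
  | dec r s =>
    intro s' hs
    refine ⟨_, .dec _ _, fun q => ?_, fun q hq => ?_⟩
    · by_cases e : q = r
      · subst e; simp [hs]
      · simp [e, hs]
    · simp [show q ≠ r + N by omega]
  | seq _ _ ih1 ih2 =>
    intro s' hs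
    obtain ⟨t', h1, h2, h3⟩ := ih1 s' hs
    obtain ⟨u', h4, h5, h6⟩ := ih2 t' h2
    exact ⟨u', .seq h1 h4, h5, fun r hr => (h6 r hr).trans (h3 r hr)⟩
  | loop_done h =>
    intro s' hs
    exact ⟨s', .loop_done (by rw [hs]; exact h), hs, fun _ _ => rfl⟩
  | loop_step h _ _ ih1 ih2 =>
    intro s' hs
    obtain ⟨t', h1, h2, h3⟩ := ih1 s' hs
    obtain ⟨u', h4, h5, h6⟩ := ih2 t' h2
    exact ⟨u', .loop_step (by rw [hs]; exact h) h1 h4, h5, fun r hr => (h6 r hr).trans (h3 r hr)⟩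

/-- Set a register to zero. -/
def Prog.clear (a : ℕ) : Prog := .loop a (.dec a)

theorem Prog.runs_clear (M a : ℕ) (s : ℕ → ℕ) :
    ∃ t, (Prog.clear a).Runs M s t ∧ t a = 0 ∧ ∀ r, r ≠ a → t r = s r := by
  obtain ⟨v, hv⟩ : ∃ v, s a = v := ⟨_, rfl⟩
  induction v generalizing s with
  | zero => exact ⟨s, .loop_done hv, hv, fun _ _ => rfl⟩
  | succ v ih =>
    obtain ⟨t, h1, h2, h3⟩ := ih (Function.update s a (s a - 1)) (by simp [hv])
    exact ⟨t, .loop_step (by omega) (.dec _ _) h1, h2, fun r hr => by rw [h3 r hr]; simp [hr]⟩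

/-- Add register `a` to register `b` and clear `a`. -/
def Prog.move (a b : ℕ) : Prog := .loop a (.seq (.dec a) (.inc b))

theorem Prog.runs_move {M a b : ℕ} (hab : a ≠ b) (s : ℕ → ℕ) (hM : s b + s a ≤ M) :
    ∃ t, (Prog.move a b).Runs M s t ∧ t a = 0 ∧ t b = s b + s a ∧
      ∀ r, r ≠ a → r ≠ b → t r = s r := by
  obtain ⟨v, hv⟩ : ∃ v, s a = v := ⟨_, rfl⟩
  induction v generalizing s with
  | zero => exact ⟨s, .loop_done hv, hv, by omega, fun _ _ _ => rfl⟩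
  | succ v ih =>
    set s1 := Function.update s a (s a - 1) with hs1
    have e1 : s1 b = s b := by simp [hs1, hab.symm]
    set s2 := Function.update s1 b (s1 b + 1) with hs2
    have e2 : s2 a = v := by simp [hs2, hs1, hab, hv]
    have e3 : s2 b = s b + 1 := by simp [hs2, e1]
    obtain ⟨t, h1, h2, h3, h4⟩ := ih s2 (by omega) e2
    refine ⟨t, .loop_step (by omega) (.seq (.dec _ _) (.inc _ _ (by rw [← hs1]; omega))) h1, h2,
      by omega, fun r ha hb => ?_⟩
    rw [h4 r ha hb]
    simp [hs2, hs1, ha, hb]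

/-- Add register `a` to the registers `b` and `c` and clear `a`. -/
def Prog.fork (a b c : ℕ) : Prog := .loop a (.seq (.dec a) (.seq (.inc b) (.inc c)))

theorem Prog.runs_fork {M a b c : ℕ} (hab : a ≠ b) (hac : a ≠ c) (hbc : b ≠ c) (s : ℕ → ℕ)
    (hb : s b + s a ≤ M) (hc : s c + s a ≤ M) :
    ∃ t, (Prog.fork a b c).Runs M s t ∧ t a = 0 ∧ t b = s b + s a ∧ t c = s c + s a ∧
      ∀ r, r ≠ a → r ≠ b → r ≠ c → t r = s r := by
  obtain ⟨v, hv⟩ : ∃ v, s a = v := ⟨_, rfl⟩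
  induction v generalizing s with
  | zero => exact ⟨s, .loop_done hv, hv, by omega, by omega, fun _ _ _ _ => rfl⟩
  | succ v ih =>
    set s1 := Function.update s a (s a - 1) with hs1
    have e1 : s1 b = s b := by simp [hs1, hab.symm]
    set s2 := Function.update s1 b (s1 b + 1) with hs2
    have e2 : s2 c = s c := by simp [hs2, hs1, hac.symm, hbc.symm]
    set s3 := Function.update s2 c (s2 c + 1) with hs3
    have e3 : s3 a = v := by simp [hs3, hs2, hs1, hab, hac, hv]
    have e4 : s3 b = s b + 1 := by simp [hs3, hs2, hbc, e1]
    have e5 : s3 c = s c + 1 := by simp [hs3, e2]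
    obtain ⟨t, h1, h2, h3, h4, h5⟩ := ih s3 (by omega) (by omega) e3
    refine ⟨t, .loop_step (by omega) (.seq (.dec _ _) (.seq (.inc _ _ (by rw [← hs1]; omega))
      (.inc _ _ (by rw [← hs1, ← hs2]; omega)))) h1, h2, by omega, by omega, fun r ra rb rc => ?_⟩
    rw [h5 r ra rb rc]
    simp [hs3, hs2, hs1, ra, rb, rc]

/-- Copy register `a` to the empty register `b` by means of the empty register `c`. -/
def Prog.copy (a b c : ℕ) : Prog := .seq (.fork a b c) (.move c a)

theorem Prog.runs_copy {M a b c : ℕ} (hab : a ≠ b) (hac : a ≠ c) (hbc : b ≠ c) (s : ℕ → ℕ)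
    (hb : s b = 0) (hc : s c = 0) (hM : s a ≤ M) :
    ∃ t, (Prog.copy a b c).Runs M s t ∧ t b = s a ∧ ∀ r, r ≠ b → t r = s r := by
  obtain ⟨t, h1, h2, h3, h4, h5⟩ := Prog.runs_fork (M := M) hab hac hbc s (by omega) (by omega)
  obtain ⟨u, g1, g2, g3, g4⟩ := Prog.runs_move (M := M) hac.symm t (by omega)
  refine ⟨u, .seq h1 g1, by rw [g4 b hbc hab.symm]; omega, fun r hr => ?_⟩
  by_cases ra : r = a
  · subst ra; omega
  by_cases rc : r = c
  · subst rc; omega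
  rw [g4 r rc ra, h5 r ra hr rc]

/-! ### Closure properties of logspace computability -/

/-- The summand 2 matches the one in the space bound `(k + i + 2) ^ d`. -/
theorem pow_add_pow_add_two_le {X a b : ℕ} (hX : 2 ≤ X) : X ^ a + X ^ b + 2 ≤ X ^ (a + b + 2) := by
  have h0 : 0 < X := by omega
  have ha : X ^ a ≤ X ^ (a + b) := Nat.pow_le_pow_right h0 (by omega)
  have hb : X ^ b ≤ X ^ (a + b) := Nat.pow_le_pow_right h0 (by omega)
  have h1 : 1 ≤ X ^ (a + b) := Nat.one_le_pow _ _ h0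
  have h4 : 4 ≤ X ^ 2 := by nlinarith
  rw [pow_add X (a + b) 2]
  nlinarith

/-- Registers 0 and 1 keep the inputs and 2 is scratch. The programs for `g₁`, `g₂` and `f` get
private blocks starting at 4, `N₂` and `N`. The intermediate values are polynomially bounded, so the
space used on them by the program for `f` is a polynomial of a polynomial. -/
theorem LogspaceComputable₂.comp {f g₁ g₂ : ℕ → ℕ → ℕ} (hf : LogspaceComputable₂ f)
    (h₁ : LogspaceComputable₂ g₁) (h₂ : LogspaceComputable₂ g₂) :
    LogspaceComputable₂ fun k i => f (g₁ k i) (g₂ k i) := by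
  obtain ⟨P, d, hP⟩ := hf
  obtain ⟨P₁, d₁, hP₁⟩ := h₁
  obtain ⟨P₂, d₂, hP₂⟩ := h₂
  -- The summand 2 keeps both inputs inside the block even if the program uses fewer than two
  -- registers.
  set N₂ := 4 + 2 + P₁.regs with hN₂
  set N := N₂ + 2 + P₂.regs with hN
  refine ⟨.seq (.copy 0 4 2) (.seq (.copy 1 5 2) (.seq (P₁.shift 4)
    (.seq (.copy 0 N₂ 2) (.seq (.copy 1 (1 + N₂) 2) (.seq (P₂.shift N₂)
    (.seq (.move 4 N) (.seq (.move N₂ (1 + N)) (.seq (P.shift N)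
    (.seq (.clear 0) (.move N 0)))))))))), d₁ + d₂ + 4 + 1 + (d₁ + d₂ + 4) * (d + 1), fun k i => ?_⟩
  set X := k + i + 2 with hX
  have hX2 : 2 ≤ X := by omega
  have hX0 : 0 < X := by omega
  set M := X ^ (d₁ + d₂ + 4 + 1 + (d₁ + d₂ + 4) * (d + 1)) with hM
  have mono : ∀ {e}, e ≤ d₁ + d₂ + 4 + 1 + (d₁ + d₂ + 4) * (d + 1) → X ^ e ≤ M :=
    fun h => Nat.pow_le_pow_right hX0 h
  have hXM : X ≤ M := by simpa using mono (e := 1) (by omega)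
  obtain ⟨t₁, r₁, v₁⟩ := hP₁ k i
  obtain ⟨t₂, r₂, v₂⟩ := hP₂ k i
  obtain ⟨t₃, r₃, v₃⟩ := hP (g₁ k i) (g₂ k i)
  have inX : ∀ r, Prog.input k i r ≤ X := fun r => by
    simp only [Prog.input]; split_ifs <;> omega
  have b₁ : g₁ k i ≤ X ^ (d₁ + 1) := by
    rw [← v₁]
    refine (r₁.le_max 0).trans (max_le (Nat.pow_le_pow_right hX0 (by omega)) ((inX 0).trans ?_))
    exact Nat.le_self_pow (by omega) X
  have b₂ : g₂ k i ≤ X ^ (d₂ + 1) := by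
    rw [← v₂]
    refine (r₂.le_max 0).trans (max_le (Nat.pow_le_pow_right hX0 (by omega)) ((inX 0).trans ?_))
    exact Nat.le_self_pow (by omega) X
  -- Raised to the power `d`, this bound needs the exponent `(d₁ + d₂ + 4) * d`, which explains the
  -- product in the exponent of `M`.
  have b₃ : g₁ k i + g₂ k i + 2 ≤ X ^ (d₁ + d₂ + 4) := by
    refine le_trans ?_ ((pow_add_pow_add_two_le (a := d₁ + 1) (b := d₂ + 1) hX2).trans
      (Nat.pow_le_pow_right hX0 (by omega)))
    omega
  have b₄ : (g₁ k i + g₂ k i + 2) ^ d ≤ M :=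
    (Nat.pow_le_pow_left b₃ d).trans (by
      rw [← pow_mul]; exact mono (by nlinarith))
  have b₅ : g₁ k i + g₂ k i + 2 ≤ M := b₃.trans (mono (by omega))
  have b₆ : f (g₁ k i) (g₂ k i) ≤ M := by
    rw [← v₃]
    refine (r₃.le_max 0).trans (max_le b₄ ?_)
    change g₁ k i ≤ M
    omega
  have i0 : Prog.input k i 0 = k := rfl
  have i1 : Prog.input k i 1 = i := rfl
  have ir : ∀ r, 2 ≤ r → Prog.input k i r = 0 := fun r hr => by
    simp only [Prog.input]
    rw [if_neg (by omega), if_neg (by omega)]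
  obtain ⟨s1, c1, e1, f1⟩ := Prog.runs_copy (M := M) (a := 0) (b := 4) (c := 2) (by omega)
    (by omega) (by omega) (Prog.input k i) (ir _ (by omega)) (ir _ (by omega)) (by omega)
  obtain ⟨s2, c2, e2, f2⟩ := Prog.runs_copy (M := M) (a := 1) (b := 5) (c := 2) (by omega)
    (by omega) (by omega) s1 (by rw [f1 _ (by omega), ir _ (by omega)])
    (by rw [f1 _ (by omega), ir _ (by omega)]) (by rw [f1 _ (by omega)]; omega)
  have z2 : ∀ r, 2 ≤ r → r ≠ 4 → r ≠ 5 → s2 r = 0 := fun r h h4 h5 => by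
    rw [f2 _ h5, f1 _ h4, ir _ h]
  have s20 : s2 0 = k := by rw [f2 _ (by omega), f1 _ (by omega), i0]
  have s21 : s2 1 = i := by rw [f2 _ (by omega), f1 _ (by omega), i1]
  have s24 : s2 4 = k := by rw [f2 _ (by omega), e1, i0]
  have s25 : s2 5 = i := by rw [e2, f1 _ (by omega), i1]
  obtain ⟨s3, c3, e3, f3⟩ := (r₁.mono (mono (by omega))).shift 4 s2 (fun r => by
    rcases r with _ | _ | r
    · exact s24
    · exact s25
    · rw [z2 _ (by omega) (by omega) (by omega), ir _ (by omega)])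
  have z3 : ∀ r, N₂ ≤ r → s3 r = 0 := fun r h => by
    obtain ⟨q, rfl⟩ : ∃ q, r = q + 4 := ⟨r - 4, by omega⟩
    rw [e3, r₁.frame (by omega), ir _ (by omega)]
  have s34 : s3 4 = g₁ k i := (e3 0).trans v₁
  obtain ⟨s4, c4, e4, f4⟩ := Prog.runs_copy (M := M) (a := 0) (b := N₂) (c := 2) (by omega)
    (by omega) (by omega) s3 (z3 _ le_rfl)
    (by rw [f3 _ (by omega), z2 _ (by omega) (by omega) (by omega)])
    (by rw [f3 _ (by omega)]; omega)
  obtain ⟨s5, c5, e5, f5⟩ := Prog.runs_copy (M := M) (a := 1) (b := 1 + N₂) (c := 2) (by omega)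
    (by omega) (by omega) s4 (by rw [f4 _ (by omega), z3 _ (by omega)])
    (by rw [f4 _ (by omega), f3 _ (by omega), z2 _ (by omega) (by omega) (by omega)])
    (by rw [f4 _ (by omega), f3 _ (by omega)]; omega)
  obtain ⟨s6, c6, e6, f6⟩ := (r₂.mono (mono (by omega))).shift N₂ s5 (fun r => by
    rcases r with _ | _ | r
    · rw [f5 _ (by omega), zero_add, e4, f3 _ (by omega), s20, i0]
    · rw [zero_add, e5, f4 _ (by omega), f3 _ (by omega), s21, i1]
    · rw [f5 _ (by omega), f4 _ (by omega), z3 _ (by omega), ir _ (by omega)])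
  have z6 : ∀ r, N ≤ r → s6 r = 0 := fun r h => by
    obtain ⟨q, rfl⟩ : ∃ q, r = q + N₂ := ⟨r - N₂, by omega⟩
    rw [e6, r₂.frame (by omega), ir _ (by omega)]
  have s64 : s6 4 = g₁ k i := by rw [f6 _ (by omega), f5 _ (by omega), f4 _ (by omega), s34]
  have s6N : s6 N₂ = g₂ k i := by simpa [v₂] using e6 0
  obtain ⟨s7, c7, d7, e7, f7⟩ := Prog.runs_move (M := M) (a := 4) (b := N) (by omega) s6
    (by rw [z6 _ le_rfl]; omega)
  obtain ⟨s8, c8, d8, e8, f8⟩ := Prog.runs_move (M := M) (a := N₂) (b := 1 + N) (by omega) s7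
    (by rw [f7 _ (by omega) (by omega), f7 _ (by omega) (by omega), z6 _ (by omega)]; omega)
  obtain ⟨s9, c9, e9, f9⟩ := (r₃.mono b₄).shift N s8 (fun r => by
    rcases r with _ | _ | r
    · rw [f8 _ (by omega) (by omega), zero_add, e7, z6 _ le_rfl, s64, zero_add]; rfl
    · rw [zero_add, e8, f7 _ (by omega) (by omega), f7 _ (by omega) (by omega), z6 _ (by omega),
        s6N, zero_add]; rfl
    · rw [f8 _ (by omega) (by omega), f7 _ (by omega) (by omega), z6 _ (by omega)]; rfl)
  have s9N : s9 N = f (g₁ k i) (g₂ k i) := by simpa [v₃] using e9 0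
  obtain ⟨s10, c10, e10, f10⟩ := Prog.runs_clear M 0 s9
  obtain ⟨s11, c11, _, e11, _⟩ := Prog.runs_move (M := M) (a := N) (b := 0) (by omega) s10
    (by rw [e10, f10 _ (by omega)]; omega)
  refine ⟨s11, .seq c1 (.seq c2 (.seq c3 (.seq c4 (.seq c5 (.seq c6 (.seq c7 (.seq c8 (.seq c9
    (.seq c10 c11))))))))), ?_⟩
  rw [e11, e10, f10 _ (by omega), s9N, zero_add]

theorem logspaceComputable₂_fst : LogspaceComputable₂ fun k _ => k :=
  -- Register 2 is empty at the start, so the loop does nothing and leaves the first input in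
  -- register 0.
  ⟨.loop 2 (.dec 2), 0, fun _ _ => ⟨_, .loop_done rfl, rfl⟩⟩

theorem le_add_add_two_pow_one (k i : ℕ) : k + i ≤ (k + i + 2) ^ 1 := by rw [pow_one]; omega

theorem logspaceComputable₂_add : LogspaceComputable₂ fun k i => k + i := by
  refine ⟨.move 1 0, 1, fun k i => ?_⟩
  obtain ⟨t, h1, _, h3, _⟩ := Prog.runs_move (a := 1) (b := 0) (by omega) (Prog.input k i)
    (M := (k + i + 2) ^ 1) (le_add_add_two_pow_one k i)
  exact ⟨t, h1, h3⟩

theorem logspaceComputable₂_snd : LogspaceComputable₂ fun _ i => i := by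
  refine ⟨.seq (.clear 0) (.move 1 0), 1, fun k i => ?_⟩
  obtain ⟨s, g1, g2, g3⟩ := Prog.runs_clear ((k + i + 2) ^ 1) 0 (Prog.input k i)
  have hs : s 1 = i := g3 1 (by omega)
  have hM := le_add_add_two_pow_one k i
  obtain ⟨t, h1, _, h3, _⟩ := Prog.runs_move (a := 1) (b := 0) (M := (k + i + 2) ^ 1) (by omega) s
    (by omega)
  exact ⟨t, .seq g1 h1, by rw [h3, g2, hs, zero_add]⟩

/-- Subtract register `b` from register `a` and clear `b`. -/
theorem Prog.runs_sub (M : ℕ) {a b : ℕ} (hab : a ≠ b) (s : ℕ → ℕ) :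
    ∃ t, (Prog.loop b (.seq (.dec b) (.dec a))).Runs M s t ∧ t a = s a - s b := by
  obtain ⟨v, hv⟩ : ∃ v, s b = v := ⟨_, rfl⟩
  induction v generalizing s with
  | zero => exact ⟨s, .loop_done hv, by omega⟩
  | succ v ih =>
    set s1 := Function.update s b (s b - 1) with hs1
    have e1 : s1 a = s a := by simp [hs1, hab]
    set s2 := Function.update s1 a (s1 a - 1) with hs2
    have e2 : s2 b = v := by simp [hs2, hs1, hab.symm, hv]
    have e3 : s2 a = s a - 1 := by simp [hs2, e1]
    obtain ⟨t, h1, h2⟩ := ih s2 e2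
    exact ⟨t, .loop_step (by omega) (.seq (.dec _ _) (.dec _ _)) h1, by omega⟩

theorem logspaceComputable₂_sub : LogspaceComputable₂ fun k i => k - i :=
  ⟨.loop 1 (.seq (.dec 1) (.dec 0)), 0, fun k i => Prog.runs_sub _ (by omega) (Prog.input k i)⟩

theorem logspaceComputable₂_cond : LogspaceComputable₂ fun k i => if k = 0 then i else 0 := by
  refine ⟨.seq (.loop 0 (.seq (.clear 1) (.clear 0))) (.move 1 0), 1, fun k i => ?_⟩
  have key : ∃ s, (Prog.loop 0 (.seq (.clear 1) (.clear 0))).Runs ((k + i + 2) ^ 1)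
      (Prog.input k i) s ∧ s 0 = 0 ∧ s 1 = if k = 0 then i else 0 := by
    by_cases hk : k = 0
    · subst hk
      exact ⟨_, .loop_done rfl, rfl, rfl⟩
    · obtain ⟨s, g1, g2, g3⟩ := Prog.runs_clear ((k + i + 2) ^ 1) 1 (Prog.input k i)
      obtain ⟨t, h1, h2, h3⟩ := Prog.runs_clear ((k + i + 2) ^ 1) 0 s
      exact ⟨t, .loop_step hk (.seq g1 h1) (.loop_done h2), h2, by
        rw [if_neg hk, h3 _ (by omega), g2]⟩
  obtain ⟨s, g1, g2, g3⟩ := key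
  obtain ⟨t, h1, _, h3, _⟩ := Prog.runs_move (a := 1) (b := 0) (M := (k + i + 2) ^ 1) (by omega) s
    (by have := le_add_add_two_pow_one k i; rw [g2, g3]; split_ifs <;> omega)
  exact ⟨t, .seq g1 h1, by rw [h3, g2, g3, zero_add]⟩

theorem logspaceComputable₂_zero : LogspaceComputable₂ fun _ _ => 0 := by
  refine ⟨.clear 0, 0, fun k i => ?_⟩
  obtain ⟨t, h1, h2, _⟩ := Prog.runs_clear ((k + i + 2) ^ 0) 0 (Prog.input k i)
  exact ⟨t, h1, h2⟩

theorem logspaceComputable₂_one : LogspaceComputable₂ fun _ _ => 1 := by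
  refine ⟨.seq (.clear 0) (.inc 0), 0, fun k i => ?_⟩
  obtain ⟨t, h1, h2, _⟩ := Prog.runs_clear ((k + i + 2) ^ 0) 0 (Prog.input k i)
  exact ⟨_, .seq h1 (.inc 0 t (by simp [h2])), by simp [h2]⟩

namespace LogspaceComputable₂

variable {f g p q : ℕ → ℕ → ℕ}

theorem add (hf : LogspaceComputable₂ f) (hg : LogspaceComputable₂ g) :
    LogspaceComputable₂ fun k i => f k i + g k i := logspaceComputable₂_add.comp hf hg

theorem sub (hf : LogspaceComputable₂ f) (hg : LogspaceComputable₂ g) :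
    LogspaceComputable₂ fun k i => f k i - g k i := logspaceComputable₂_sub.comp hf hg

theorem const (n : ℕ) : LogspaceComputable₂ fun _ _ => n := by
  induction n with
  | zero => exact logspaceComputable₂_zero
  | succ n ih => exact ih.add logspaceComputable₂_one

theorem ite_le (hp : LogspaceComputable₂ p) (hq : LogspaceComputable₂ q)
    (hf : LogspaceComputable₂ f) (hg : LogspaceComputable₂ g) :
    LogspaceComputable₂ fun k i => if p k i ≤ q k i then f k i else g k i := by
  -- Truncated subtraction makes `p ≤ q` a zero test. The second summand is `g - g = 0` if the test
  -- succeeds and `g - 0` otherwise.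
  have h := (logspaceComputable₂_cond.comp (hp.sub hq) hf).add
    (hg.sub (logspaceComputable₂_cond.comp (hp.sub hq) hg))
  convert h using 3 with k i
  simp only [Nat.sub_eq_zero_iff_le]
  split_ifs <;> omega

theorem ite_lt (hp : LogspaceComputable₂ p) (hq : LogspaceComputable₂ q)
    (hf : LogspaceComputable₂ f) (hg : LogspaceComputable₂ g) :
    LogspaceComputable₂ fun k i => if p k i < q k i then f k i else g k i :=
  ite_le (hp.add (const 1)) hq hf hg

theorem ite_eq (hp : LogspaceComputable₂ p) (hq : LogspaceComputable₂ q)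
    (hf : LogspaceComputable₂ f) (hg : LogspaceComputable₂ g) :
    LogspaceComputable₂ fun k i => if p k i = q k i then f k i else g k i := by
  have h := ite_le hp hq (ite_le hq hp hf hg) hg
  convert h using 3 with k i
  split_ifs <;> first | rfl | omega

end LogspaceComputable₂

namespace LogspaceComputable

variable {f g : ℕ → ℕ}

theorem toFst (hf : LogspaceComputable f) : LogspaceComputable₂ fun k _ => f k := hf

theorem add (hf : LogspaceComputable f) (hg : LogspaceComputable g) :
    LogspaceComputable fun k => f k + g k := LogspaceComputable₂.add hf hg

theorem const (n : ℕ) : LogspaceComputable fun _ => n := LogspaceComputable₂.const n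

end LogspaceComputable

/-! ### Closure properties of uniform families -/

theorem LogspaceUniform.nil : LogspaceUniform fun _ => [] :=
  ⟨LogspaceComputable.const 0, fun _ => by simpa using LogspaceComputable₂.const 0⟩

theorem LogspaceUniform.append {l₁ l₂ : ℕ → List (Fin 4 → ℕ)} (h₁ : LogspaceUniform l₁)
    (h₂ : LogspaceUniform l₂) : LogspaceUniform fun k => l₁ k ++ l₂ k := by
  refine ⟨by simpa using h₁.1.add h₂.1, fun j => ?_⟩
  have h := LogspaceComputable₂.ite_lt logspaceComputable₂_snd h₁.1.toFst (h₁.2 j)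
    ((h₂.2 j).comp logspaceComputable₂_fst (logspaceComputable₂_snd.sub h₁.1.toFst))
  convert h using 3 with k i
  split_ifs with hi
  · rw [List.getD_append _ _ _ _ hi]
  · rw [List.getD_append_right _ _ _ _ (by omega)]

theorem LogspaceUniform.reverse {l : ℕ → List (Fin 4 → ℕ)} (h : LogspaceUniform l) :
    LogspaceUniform fun k => (l k).reverse := by
  refine ⟨by simpa using h.1, fun j => ?_⟩
  have h := LogspaceComputable₂.ite_lt logspaceComputable₂_snd h.1.toFst
    ((h.2 j).comp logspaceComputable₂_fst
      ((h.1.toFst.sub (LogspaceComputable₂.const 1)).sub logspaceComputable₂_snd))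
    (LogspaceComputable₂.const 0)
  convert h using 3 with k i
  split_ifs with hi
  · rw [List.getD_reverse _ hi]
  · rw [List.getD_eq_default _ _ (by simpa using hi)]

/-- `hT0` makes the transformation compatible with the default entry beyond the end of the list;
`hT` says that it preserves logspace computability entrywise. -/
theorem LogspaceUniform.map {l : ℕ → List (Fin 4 → ℕ)} (h : LogspaceUniform l)
    (T : ℕ → (Fin 4 → ℕ) → Fin 4 → ℕ) (hT0 : ∀ k, T k (fun _ => 0) = fun _ => 0)
    (hT : ∀ c : Fin 4 → ℕ → ℕ → ℕ, (∀ j, LogspaceComputable₂ (c j)) →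
      ∀ j, LogspaceComputable₂ fun k i => T k (fun j => c j k i) j) :
    LogspaceUniform fun k => (l k).map (T k) := by
  refine ⟨by simpa using h.1, fun j => ?_⟩
  have := hT (fun j k i => (l k).getD i (fun _ => 0) j) h.2 j
  convert this using 3 with k i
  conv_lhs => rw [← hT0 k, List.getD_map]

theorem LogspaceUniform.ofFn {m : ℕ → ℕ} (hm : LogspaceComputable m) (c : Fin 4 → ℕ → ℕ → ℕ)
    (hc : ∀ j, LogspaceComputable₂ (c j)) :
    LogspaceUniform fun k => List.ofFn fun i : Fin (m k) => fun j => c j k i := by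
  refine ⟨by simpa using hm, fun j => ?_⟩
  have h := LogspaceComputable₂.ite_lt logspaceComputable₂_snd hm.toFst (hc j)
    (LogspaceComputable₂.const 0)
  convert h using 3 with k i
  split_ifs with hi
  · simp [List.getD_eq_getElem?_getD, hi]
  · rw [List.getD_eq_default _ _ (by simpa using hi)]

end CompiledGames

namespace CompiledGames

/-! ### Gates as operators on states -/

variable {w W : ℕ}

theorem CGate.act_act (g : CGate w) (z : Bits w) : g.act (g.act z) = z := by
  cases g with
  | x i => simp [CGate.act]
  | cnot i j h => simp [CGate.act, h]
  | ccnot i j l hij hil hjl => simp [CGate.act, hil, hjl]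

/-- Classical gates are involutions, so pushing basis states forward is the same as precomposing
with the action. -/
theorem CGate.mat_mulVec (g : CGate w) (φ : Bits w → ℂ) :
    (Gate.cl g).mat *ᵥ φ = fun z => φ (g.act z) := by
  ext z
  have h : ∀ z', (z = g.act z') = (z' = g.act z) := fun z' =>
    propext ⟨fun h => by rw [h, g.act_act], fun h => by rw [h, g.act_act]⟩
  simp [Gate.mat, Matrix.mulVec, dotProduct, h]

theorem Gate.had_mulVec (i : Fin w) (φ : Bits w → ℂ) :
    (Gate.had i).mat *ᵥ φ = fun z => (φ (Function.update z i false) +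
      (if z i then -1 else 1) * φ (Function.update z i true)) * (1 / (Real.sqrt 2 : ℂ)) := by
  ext z
  have hne : Function.update z i false ≠ Function.update z i true := fun h => by
    simpa using congrFun h i
  have hP : ∀ z' : Bits w, (∀ j, j ≠ i → z j = z' j) ↔
      z' ∈ ({Function.update z i false, Function.update z i true} : Finset (Bits w)) := by
    intro z'
    simp only [Finset.mem_insert, Finset.mem_singleton]
    constructor
    · intro h
      have : z' = Function.update z i (z' i) := by
        ext j
        by_cases hj : j = i
        · subst hj; simp
        · simp [hj, h j hj]
      cases hz : z' i <;> rw [hz] at this <;> simp [this]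
    · rintro (rfl | rfl) j hj <;> simp [hj]
  simp only [Gate.mat, Matrix.mulVec, dotProduct, Matrix.of_apply, hP, ite_mul, zero_mul]
  rw [Finset.sum_ite_mem, Finset.univ_inter, Finset.sum_pair hne]
  simp only [Function.update_self]
  cases z i <;> simp <;> ring

/-- The inverse gate. -/
def Gate.inv : Gate w → Gate w
  | .cl g => .cl g
  | .had i => .had i
  | .tee i => .teeInv i
  | .teeInv i => .tee i

theorem Gate.mat_inv (g : Gate w) : g.inv.mat = g.matᴴ := by
  cases g with
  | cl g =>
    ext z z'
    have h : (z' = g.act z) ↔ (z = g.act z') :=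
      ⟨fun h => by rw [h, g.act_act], fun h => by rw [h, g.act_act]⟩
    simp only [Gate.inv, Gate.mat, Matrix.conjTranspose_apply, Matrix.of_apply, h]
    split_ifs <;> simp
  | had i =>
    ext z z'
    have h : (∀ j, j ≠ i → z' j = z j) ↔ (∀ j, j ≠ i → z j = z' j) :=
      ⟨fun h j hj => (h j hj).symm, fun h j hj => (h j hj).symm⟩
    simp only [Gate.inv, Gate.mat, Matrix.conjTranspose_apply, Matrix.of_apply, h]
    split_ifs <;> simp_all
  | tee i =>
    simp only [Gate.inv, Gate.mat, Matrix.diagonal_conjTranspose]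
    congr 1
    ext z
    simp only [Pi.star_apply]
    split_ifs
    · simp [← Complex.exp_conj, Complex.conj_ofNat]
    · simp
  | teeInv i =>
    simp only [Gate.inv, Gate.mat, Matrix.diagonal_conjTranspose]
    congr 1
    ext z
    simp only [Pi.star_apply]
    split_ifs
    · simp [← Complex.exp_conj, Complex.conj_ofNat]
    · simp

theorem Gate.inv_mul (g : Gate w) : g.inv.mat * g.mat = 1 := by
  cases g with
  | cl g =>
    refine Matrix.ext_of_mulVec_single fun z => ?_
    rw [← Matrix.mulVec_mulVec, Gate.inv, CGate.mat_mulVec, CGate.mat_mulVec, Matrix.one_mulVec]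
    simp only [CGate.act_act]
  | had i =>
    have h2 : (1 / (Real.sqrt 2 : ℂ)) * (1 / (Real.sqrt 2 : ℂ)) = 1 / 2 := by
      rw [← mul_div_mul_comm, ← Complex.ofReal_mul, Real.mul_self_sqrt (by norm_num)]
      norm_num
    refine Matrix.ext_of_mulVec_single fun z => ?_
    rw [← Matrix.mulVec_mulVec, Gate.inv, Gate.had_mulVec, Gate.had_mulVec, Matrix.one_mulVec]
    ext u
    generalize (Pi.single z (1 : ℂ) : Bits w → ℂ) = φ
    simp only [Function.update_self, Function.update_idem]
    have hu : φ u =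
        if u i then φ (Function.update u i true) else φ (Function.update u i false) := by
      cases h : u i <;> simp [← h]
    rw [hu]
    cases u i
    · simp only [Bool.false_eq_true, if_false, if_true]
      linear_combination (2 * φ (Function.update u i false)) * h2
    · simp only [Bool.false_eq_true, if_false, if_true]
      linear_combination (2 * φ (Function.update u i true)) * h2
  | tee i =>
    simp only [Gate.inv, Gate.mat, Matrix.diagonal_mul_diagonal]
    rw [← Matrix.diagonal_one]
    congr 1
    ext z
    split_ifs
    · rw [← Complex.exp_add]; simp
    · simp
  | teeInv i =>
    simp only [Gate.inv, Gate.mat, Matrix.diagonal_mul_diagonal]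
    rw [← Matrix.diagonal_one]
    congr 1
    ext z
    split_ifs
    · rw [← Complex.exp_add]; simp
    · simp

theorem Circuit.mat_append (C D : Circuit w) : Circuit.mat (C ++ D) = D.mat * C.mat := by
  induction C with
  | nil => simp [Circuit.mat]
  | cons g C ih => rw [List.cons_append, Circuit.mat, ih, Circuit.mat, Matrix.mul_assoc]

/-- The inverse circuit. -/
def Circuit.inv (C : Circuit w) : Circuit w := (C.map Gate.inv).reverse

theorem Circuit.inv_mul (C : Circuit w) : C.inv.mat * C.mat = 1 := by
  induction C with
  | nil => simp [Circuit.inv, Circuit.mat]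
  | cons g C ih =>
    rw [Circuit.inv, List.map_cons, List.reverse_cons, Circuit.mat_append, Circuit.mat,
      Circuit.mat, Circuit.mat, Matrix.one_mul, Matrix.mul_assoc,
      ← Matrix.mul_assoc _ (Circuit.mat C)]
    change g.inv.mat * (Circuit.mat (Circuit.inv C) * Circuit.mat C * g.mat) = 1
    rw [ih, Matrix.one_mul, g.inv_mul]

theorem Circuit.mat_inv (C : Circuit w) : C.inv.mat = C.matᴴ := by
  induction C with
  | nil => simp [Circuit.inv, Circuit.mat]
  | cons g C ih =>
    rw [Circuit.inv, List.map_cons, List.reverse_cons, Circuit.mat_append, Circuit.mat,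
      Circuit.mat, Circuit.mat, Matrix.one_mul, Matrix.conjTranspose_mul, ← ih, g.mat_inv]
    rfl

theorem Circuit.conjTranspose_mul_mat (C : Circuit w) : C.matᴴ * C.mat = 1 := by
  rw [← C.mat_inv, C.inv_mul]

/-! ### Loading and measuring -/

theorem Bits.bit_append_left {h l : ℕ} (u : Bits h) (v : Bits l) {i : ℕ} (hi : i < h) :
    Bits.bit (w := h + l) (Fin.append u v) i = u ⟨i, hi⟩ := by
  rw [Bits.bit, dif_pos (by omega)]
  exact Fin.append_left u v ⟨i, hi⟩

theorem Bits.bit_append_right {h l : ℕ} (u : Bits h) (v : Bits l) {i : ℕ} (hi : h ≤ i) :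
    Bits.bit (w := h + l) (Fin.append u v) i = v.bit (i - h) := by
  unfold Bits.bit
  by_cases hl : i < h + l
  · rw [dif_pos hl, dif_pos (by omega)]
    have : (⟨i, hl⟩ : Fin (h + l)) = Fin.natAdd h ⟨i - h, by omega⟩ := by
      ext; simp; omega
    rw [this, Fin.append_right]
  · rw [dif_neg hl, dif_neg (by omega)]

theorem eq_resize_append_iff {h l : ℕ} (hw : h ≤ w) (z : Bits w) (u : Bits h) (v : Bits l) :
    z = Bits.resize w (Fin.append u v : Bits (h + l)) ↔
      (∀ r : Fin w, h ≤ r → z r = v.bit (r - h)) ∧ (fun r => z (Fin.castLE hw r)) = u := by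
  constructor
  · rintro rfl
    refine ⟨fun r hr => Bits.bit_append_right u v hr, ?_⟩
    ext r
    exact Bits.bit_append_left u v r.2
  · rintro ⟨h1, rfl⟩
    ext r
    by_cases hr : r.val < h
    · exact (Bits.bit_append_left (fun r => z (Fin.castLE hw r)) v hr).symm
    · rw [h1 r (by omega)]
      exact (Bits.bit_append_right _ v (by omega)).symm

theorem load_mulVec {h l : ℕ} (hw : h ≤ w) (v : Bits l) (u : Bits h → ℂ) :
    load w h v *ᵥ u = fun z => if ∀ r : Fin w, h ≤ r → z r = v.bit (r - h) then
      u (fun r => z (Fin.castLE hw r)) else 0 := by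
  ext z
  simp only [load, Matrix.mulVec, dotProduct, Matrix.of_apply, eq_resize_append_iff hw]
  by_cases h1 : ∀ r : Fin w, h ≤ r → z r = v.bit (r - h)
  · simp only [and_iff_right h1, if_pos h1]
    simp
  · simp only [h1, false_and, if_false]
    simp

theorem load_isometry {h l : ℕ} (hw : h ≤ w) (v : Bits l) : (load w h v)ᴴ * load w h v = 1 := by
  refine Matrix.ext_of_mulVec_single fun u => ?_
  rw [← Matrix.mulVec_mulVec, Matrix.one_mulVec]
  generalize (Pi.single u (1 : ℂ) : Bits h → ℂ) = φ
  rw [load_mulVec hw]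
  ext u
  simp only [load, Matrix.mulVec, dotProduct, Matrix.conjTranspose_apply, Matrix.of_apply]
  rw [Finset.sum_eq_single (Bits.resize w (Fin.append u v : Bits (h + l)))]
  · obtain ⟨h1, h2⟩ := (eq_resize_append_iff hw _ u v).1 rfl
    rw [if_pos rfl, if_pos h1, h2]
    simp
  · intro z _ hz
    simp [hz]
  · simp

theorem readout_conjTranspose {m : ℕ} (α : Bits m) : (readout w α)ᴴ = readout w α := by
  rw [readout, Matrix.diagonal_conjTranspose]
  congr 1
  ext z
  simp only [Pi.star_apply]
  split_ifs <;> simp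

theorem readout_mul_self {m : ℕ} (α : Bits m) : readout w α * readout w α = readout w α := by
  rw [readout, Matrix.diagonal_mul_diagonal]
  congr 1
  ext z
  split_ifs <;> simp

theorem readout_mulVec {m : ℕ} (α : Bits m) (φ : Bits w → ℂ) :
    readout w α *ᵥ φ = fun z => if z.resize m = α then φ z else 0 := by
  ext z
  rw [readout, Matrix.mulVec_diagonal]
  split_ifs <;> simp

theorem sum_readout (w m : ℕ) : ∑ α : Bits m, readout w α = 1 := by
  ext z z'
  rw [Matrix.sum_apply]
  simp only [readout, Matrix.diagonal_apply, Matrix.one_apply]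
  split_ifs <;> simp

/-- If the effect of a circuit is a projection, then the measurement commutes with it. -/
theorem readout_mul_circuit {h l m : ℕ} (hw : h ≤ w) (C : Circuit w) (v : Bits l) (α : Bits m)
    (hP : IsStarProjection (C.effect h v α)) :
    readout w α * (C.mat * load w h v) = C.mat * load w h v * C.effect h v α := by
  set V := C.mat * load w h v with hV
  set P := C.effect h v α with hPdef
  have hVV : Vᴴ * V = 1 := by
    rw [hV, Matrix.conjTranspose_mul, Matrix.mul_assoc, ← Matrix.mul_assoc _ C.mat,
      C.conjTranspose_mul_mat, Matrix.one_mul, load_isometry hw]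
  have hPV : Vᴴ * (readout w α * V) = P := by
    rw [hPdef, Circuit.effect, hV, Matrix.conjTranspose_mul]
    simp only [Matrix.mul_assoc]
  have hPs : Pᴴ = P := hP.isSelfAdjoint
  have hPi : P * P = P := hP.isIdempotentElem
  -- With `R` the readout, `V` is an isometry and `Vᴴ R V = P`. All four products in `(R V - V P)ᴴ
  -- (R V - V P)` equal the projection `P`, so they cancel.
  rw [← sub_eq_zero, ← Matrix.conjTranspose_mul_self_eq_zero]
  have e1 : Vᴴ * readout w α * (readout w α * V) = P := by
    rw [Matrix.mul_assoc, ← Matrix.mul_assoc (readout w α), readout_mul_self, hPV]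
  have e2 : Vᴴ * readout w α * (V * P) = P := by
    rw [← Matrix.mul_assoc, Matrix.mul_assoc Vᴴ, hPV, hPi]
  have e3 : P * Vᴴ * (readout w α * V) = P := by
    rw [Matrix.mul_assoc, hPV, hPi]
  have e4 : P * Vᴴ * (V * P) = P := by
    rw [Matrix.mul_assoc, ← Matrix.mul_assoc Vᴴ, hVV, Matrix.one_mul, hPi]
  rw [Matrix.conjTranspose_sub, Matrix.conjTranspose_mul _ V, Matrix.conjTranspose_mul V P, hPs,
    readout_conjTranspose, Matrix.sub_mul, Matrix.mul_sub, Matrix.mul_sub, e1, e2, e3, e4]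
  simp

/-! ### Relocation of circuits -/

/-- The gate acting on the wires given by an embedding. -/
def CGate.map (e : Fin w ↪ Fin W) : CGate w → CGate W
  | .x i => .x (e i)
  | .cnot i j h => .cnot (e i) (e j) (e.injective.ne h)
  | .ccnot i j l hij hil hjl =>
      .ccnot (e i) (e j) (e l) (e.injective.ne hij) (e.injective.ne hil) (e.injective.ne hjl)

def Gate.map (e : Fin w ↪ Fin W) : Gate w → Gate W
  | .cl g => .cl (g.map e)
  | .had i => .had (e i)
  | .tee i => .tee (e i)
  | .teeInv i => .teeInv (e i)

def Circuit.relocate (e : Fin w ↪ Fin W) (C : Circuit w) : Circuit W := C.map (Gate.map e)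

/-- The state `φ` on the wires in the range of `e`, and the basis state `bg` on the others. -/
def lift (e : Fin w ↪ Fin W) (bg : Bits W) (φ : Bits w → ℂ) : Bits W → ℂ :=
  fun z => if ∀ j, (∀ i, e i ≠ j) → z j = bg j then φ (fun i => z (e i)) else 0

theorem update_comp_embedding (e : Fin w ↪ Fin W) (z : Bits W) (i : Fin w) (b : Bool) :
    (fun r => Function.update z (e i) b (e r)) = Function.update (fun r => z (e r)) i b := by
  ext r
  by_cases h : r = i
  · subst h; simp
  · simp [h]

theorem update_forall_iff (e : Fin w ↪ Fin W) (bg z : Bits W) (i : Fin w) (b : Bool) :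
    (∀ j, (∀ i, e i ≠ j) → Function.update z (e i) b j = bg j) ↔
      ∀ j, (∀ i, e i ≠ j) → z j = bg j := by
  refine forall₂_congr fun j hj => ?_
  rw [Function.update_of_ne (hj i).symm]

theorem Gate.map_mulVec_lift (e : Fin w ↪ Fin W) (bg : Bits W) (g : Gate w) (φ : Bits w → ℂ) :
    (g.map e).mat *ᵥ lift e bg φ = lift e bg (g.mat *ᵥ φ) := by
  cases g with
  | cl g =>
    rw [Gate.map, CGate.mat_mulVec, CGate.mat_mulVec]
    ext z
    cases g <;>
      simp only [lift, CGate.map, CGate.act, update_forall_iff, update_comp_embedding]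
  | had i =>
    rw [Gate.map, Gate.had_mulVec, Gate.had_mulVec]
    ext z
    simp only [lift, update_forall_iff, update_comp_embedding]
    split_ifs <;> simp
  | tee i =>
    ext z
    simp only [Gate.map, Gate.mat, Matrix.mulVec_diagonal, lift]
    split_ifs <;> simp
  | teeInv i =>
    ext z
    simp only [Gate.map, Gate.mat, Matrix.mulVec_diagonal, lift]
    split_ifs <;> simp

theorem Circuit.relocate_mulVec_lift (e : Fin w ↪ Fin W) (bg : Bits W) (C : Circuit w)
    (φ : Bits w → ℂ) : (C.relocate e).mat *ᵥ lift e bg φ = lift e bg (C.mat *ᵥ φ) := by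
  induction C generalizing φ with
  | nil => simp [Circuit.relocate, Circuit.mat]
  | cons g C ih =>
    change (Circuit.mat (Circuit.relocate e C) * (g.map e).mat) *ᵥ _ = _
    rw [← Matrix.mulVec_mulVec, Gate.map_mulVec_lift, ih, Matrix.mulVec_mulVec]
    rfl

theorem lift_sum {ι : Type*} (s : Finset ι) (e : Fin w ↪ Fin W) (bg : Bits W)
    (φ : ι → Bits w → ℂ) : lift e bg (∑ i ∈ s, φ i) = ∑ i ∈ s, lift e bg (φ i) := by
  ext z
  simp only [lift, Finset.sum_apply]
  split_ifs <;> simp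

/-- The initial segment of the wires. -/
def initialWires {h : ℕ} (hw : h ≤ w) : Fin h ↪ Fin w := (Fin.castLEOrderEmb hw).toEmbedding

/-- Loading needs no gates: if the background already holds the classical input and the zeroed
ancillas where the circuit expects them, only the register wires remain to be specified. Different
circuits can therefore share the same spare wires. -/
theorem lift_load {h l : ℕ} (hw : h ≤ w) (e : Fin w ↪ Fin W) (bg : Bits W) (v : Bits l)
    (u : Bits h → ℂ) (hbg : ∀ r : Fin w, h ≤ r → bg (e r) = v.bit (r - h)) :
    lift e bg (load w h v *ᵥ u) = lift ((initialWires hw).trans e) bg u := by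
  rw [load_mulVec hw]
  ext z
  simp only [lift, ← ite_and]
  refine if_congr ?_ rfl rfl
  constructor
  · rintro ⟨h1, h2⟩ j hj
    by_cases hr : ∃ r, e r = j
    · obtain ⟨r, rfl⟩ := hr
      by_cases hrh : r.val < h
      · exact absurd rfl (hj ⟨r, hrh⟩)
      · rw [h2 r (by omega), hbg r (by omega)]
    · push Not at hr
      exact h1 j hr
  · intro h1
    refine ⟨fun j hj => h1 j fun i => hj _, fun r hr => ?_⟩
    rw [← hbg r hr]
    refine h1 _ fun i hi => ?_
    have := congrArg Fin.val (e.injective hi)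
    have hi2 := i.2
    simp only [initialWires] at this
    change i.val = r.val at this
    omega

theorem lift_inner (e : Fin w ↪ Fin W) (bg : Bits W) (φ ψ : Bits w → ℂ) :
    star (lift e bg φ) ⬝ᵥ lift e bg ψ = star φ ⬝ᵥ ψ := by
  classical
  -- The support of a lifted state lies in the image of this injection, which fills the remaining
  -- wires from the background.
  let ext : Bits w → Bits W := fun u j => if h : ∃ i, e i = j then u h.choose else bg j
  have hext : ∀ u i, ext u (e i) = u i := fun u i => by
    have h : ∃ i', e i' = e i := ⟨i, rfl⟩
    simp only [ext, dif_pos h]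
    rw [e.injective h.choose_spec]
  have hext2 : ∀ u j, (∀ i, e i ≠ j) → ext u j = bg j := fun u j hj => by
    simp only [ext]
    rw [dif_neg (by push Not; exact hj)]
  symm
  refine Fintype.sum_of_injective ext (fun u u' h => ?_) _ _ (fun z hz => ?_) (fun u => ?_)
  · ext i
    rw [← hext u i, h, hext]
  · have : ¬ ∀ j, (∀ i, e i ≠ j) → z j = bg j := fun h => hz ⟨fun i => z (e i), by
      ext j
      by_cases hj : ∃ i, e i = j
      · obtain ⟨i, rfl⟩ := hj
        exact hext (fun i => z (e i)) i
      · push Not at hj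
        exact (hext2 (fun i => z (e i)) j hj).trans (h j hj).symm⟩
    simp [lift, this]
  · simp only [lift, Pi.star_apply]
    rw [if_pos (hext2 u), if_pos (hext2 u)]
    simp only [hext]

theorem lift_inner_of_ne (e : Fin w ↪ Fin W) {bg bg' : Bits W} {j : Fin W} (hj : ∀ i, e i ≠ j)
    (hbg : bg j ≠ bg' j) (φ ψ : Bits w → ℂ) : star (lift e bg φ) ⬝ᵥ lift e bg' ψ = 0 := by
  refine Finset.sum_eq_zero fun z _ => ?_
  simp only [lift, Pi.star_apply]
  split_ifs with h1 h2
  · exact absurd ((h1 j hj).symm.trans (h2 j hj)) hbg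
  all_goals simp

/-! ### Copying and measuring -/

/-- Xor the wires `f i` into the wires `g i`. -/
def copyGates {m : ℕ} (f g : Fin m → Fin W) (h : ∀ i j, f i ≠ g j) : List (CGate W) :=
  List.ofFn fun i => .cnot (f i) (g i) (h i i)

/-- The action of a classical circuit on basis states. -/
def actList (L : List (CGate W)) (z : Bits W) : Bits W := L.foldl (fun z g => g.act z) z

theorem copyGates_act {m : ℕ} (f g : Fin m → Fin W) (h : ∀ i j, f i ≠ g j)
    (hg : Function.Injective g) (z : Bits W) :
    (∀ i, actList (copyGates f g h) z (g i) = xor (z (g i)) (z (f i))) ∧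
      ∀ j, (∀ i, g i ≠ j) → actList (copyGates f g h) z j = z j := by
  induction m generalizing z with
  | zero => exact ⟨fun i => i.elim0, fun j _ => rfl⟩
  | succ m ih =>
    set z1 := Function.update z (g 0) (xor (z (g 0)) (z (f 0))) with hz1
    obtain ⟨h1, h2⟩ := ih (fun i => f i.succ) (fun i => g i.succ) (fun i j => h _ _)
      (fun i j hij => Fin.succ_injective _ (hg hij)) z1
    have key : actList (copyGates f g h) z =
        actList (copyGates (fun i : Fin m => f i.succ) (fun i => g i.succ)
          fun i j => h _ _) z1 := by
      simp only [actList, copyGates, List.ofFn_succ, List.foldl_cons]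
      rfl
    rw [key]
    refine ⟨fun i => ?_, fun j hj => ?_⟩
    · refine Fin.cases ?_ (fun i => ?_) i
      · rw [h2 _ fun i hi => Fin.succ_ne_zero i (hg hi), hz1, Function.update_self]
      · rw [h1 i, hz1, Function.update_of_ne (hg.ne (Fin.succ_ne_zero i)),
          Function.update_of_ne (h _ _)]
    · rw [h2 j fun i => hj _, hz1, Function.update_of_ne (hj 0).symm]

/-- A reversible classical circuit permutes the amplitudes; stating the hypothesis along the forward
action avoids inverting the permutation. -/
theorem mat_classical_mulVec (L : List (CGate W)) (Φ Φ' : Bits W → ℂ)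
    (h : ∀ z, Φ' (actList L z) = Φ z) : Circuit.mat (L.map Gate.cl) *ᵥ Φ = Φ' := by
  induction L generalizing Φ with
  | nil =>
    rw [List.map_nil, Circuit.mat, Matrix.one_mulVec]
    exact funext fun z => (h z).symm
  | cons g L ih =>
    rw [List.map_cons, Circuit.mat, ← Matrix.mulVec_mulVec, CGate.mat_mulVec]
    refine ih _ fun z => ?_
    have := h (g.act z)
    simp only [actList, List.foldl_cons, g.act_act] at this ⊢
    exact this

/-- On the range of the projection for outcome `α`, the source wires hold the definite string `α`,
so copying only changes the background. -/
theorem copyGates_mulVec_lift {m : ℕ} (hm : m ≤ w) (e : Fin w ↪ Fin W) (g : Fin m → Fin W)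
    (hg : Function.Injective g) (heg : ∀ i j, e i ≠ g j) (bg bg' : Bits W) (α : Bits m)
    (hbg : ∀ i, bg' (g i) = xor (bg (g i)) (α i)) (hbg' : ∀ j, (∀ i, g i ≠ j) → bg' j = bg j)
    (φ : Bits w → ℂ) :
    Circuit.mat ((copyGates (fun i => e (Fin.castLE hm i)) g fun _ _ => heg _ _).map Gate.cl) *ᵥ
      lift e bg (readout w α *ᵥ φ) = lift e bg' (readout w α *ᵥ φ) := by
  refine mat_classical_mulVec _ _ _ fun z => ?_
  obtain ⟨h1, h2⟩ := copyGates_act (fun i => e (Fin.castLE hm i)) g (fun _ _ => heg _ _) hg z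
  set z' := actList (copyGates (fun i => e (Fin.castLE hm i)) g fun _ _ => heg _ _) z
  have hz : (fun i => z' (e i)) = fun i => z (e i) := by
    ext i
    exact h2 _ fun j hj => heg i j hj.symm
  simp only [lift, hz, readout_mulVec]
  by_cases hα : Bits.resize m (fun i => z (e i)) = α
  · have hf : ∀ i, z (e (Fin.castLE hm i)) = α i := fun i => by
      rw [← hα]
      simp only [Bits.resize, Bits.bit]
      rw [dif_pos (by omega)]
      rfl
    refine if_congr (forall₂_congr fun j hj => ?_) rfl rfl
    by_cases hgj : ∃ i, g i = j
    · obtain ⟨i, rfl⟩ := hgj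
      rw [h1, hf, hbg]
      cases z (g i) <;> cases bg (g i) <;> cases α i <;> decide
    · push Not at hgj
      rw [h2 j hgj, hbg' j hgj]
  · simp [hα]

/-- Run a circuit, copy the outcome to other wires, and undo the circuit. -/
def measureGates {m : ℕ} (hm : m ≤ w) (e : Fin w ↪ Fin W) (g : Fin m → Fin W)
    (heg : ∀ i j, e i ≠ g j) (C : Circuit w) : Circuit W :=
  C.relocate e ++ ((copyGates (fun i => e (Fin.castLE hm i)) g fun _ _ => heg _ _).map Gate.cl ++
    C.inv.relocate e)

/-- For a general POVM, uncomputing after the copy would leave the ancillas entangled with the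
outcome. Here the effects are projections, so the readout passes through the circuit
(`readout_mul_circuit`). The inverse circuit then restores the ancillas exactly and leaves the
projected register in each branch. -/
theorem measureGates_mulVec {h l m : ℕ} (hw : h ≤ w) (hm : m ≤ w) (e : Fin w ↪ Fin W)
    (g : Fin m → Fin W) (hg : Function.Injective g) (heg : ∀ i j, e i ≠ g j) (C : Circuit w)
    (v : Bits l) (hP : ∀ α : Bits m, IsStarProjection (C.effect h v α)) (bg : Bits W)
    (bg' : Bits m → Bits W) (hbg : ∀ α i, bg' α (g i) = xor (bg (g i)) (α i))
    (hbg' : ∀ α j, (∀ i, g i ≠ j) → bg' α j = bg j) (u : Bits h → ℂ)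
    (hv : ∀ r : Fin w, h ≤ r → bg (e r) = v.bit (r - h)) :
    (measureGates hm e g heg C).mat *ᵥ lift ((initialWires hw).trans e) bg u =
      ∑ α, lift ((initialWires hw).trans e) (bg' α) (C.effect h v α *ᵥ u) := by
  have hsum : C.mat *ᵥ (load w h v *ᵥ u) =
      ∑ α : Bits m, readout w α *ᵥ (C.mat *ᵥ (load w h v *ᵥ u)) := by
    rw [← Matrix.sum_mulVec, sum_readout, Matrix.one_mulVec]
  rw [measureGates, Circuit.mat_append, Circuit.mat_append, ← Matrix.mulVec_mulVec,
    ← Matrix.mulVec_mulVec, ← lift_load hw e bg v u hv, Circuit.relocate_mulVec_lift, hsum,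
    lift_sum, Matrix.mulVec_sum, Matrix.mulVec_sum]
  refine Finset.sum_congr rfl fun α _ => ?_
  rw [copyGates_mulVec_lift hm e g hg heg bg (bg' α) α (hbg α) (hbg' α),
    Circuit.relocate_mulVec_lift, Matrix.mulVec_mulVec _ C.mat,
    Matrix.mulVec_mulVec _ (readout w α), readout_mul_circuit hw C v α (hP α),
    ← Matrix.mulVec_mulVec, ← Matrix.mulVec_mulVec,
    Matrix.mulVec_mulVec _ C.inv.mat, C.inv_mul, Matrix.one_mulVec]
  refine lift_load hw e (bg' α) v _ fun r hr => ?_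
  rw [hbg' α _ fun i hi => heg r i hi.symm, hv r hr]

end CompiledGames

namespace CompiledGames

variable {w W : ℕ}

/-! ### Descriptions of relocated, inverted and copying circuits -/

/-- Wires from `t` on are moved by `d + s`, the others by `d`. -/
def shiftWire (t d s r : ℕ) : ℕ := if r < t then r + d else r + d + s

def shiftWires (t d s : ℕ) (h : w + d + s ≤ W) : Fin w ↪ Fin W where
  toFun r := ⟨shiftWire t d s r, by have := r.2; unfold shiftWire; split_ifs <;> omega⟩
  inj' r r' hr := by
    have := congrArg Fin.val hr
    simp only [shiftWire] at this
    ext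
    split_ifs at this <;> omega

theorem shiftWires_val (t d s : ℕ) (h : w + d + s ≤ W) (r : Fin w) :
    (shiftWires t d s h r).val = shiftWire t d s r := rfl

theorem LogspaceComputable₂.shiftWire {t d s : ℕ → ℕ} {f : ℕ → ℕ → ℕ} (ht : LogspaceComputable t)
    (hd : LogspaceComputable d) (hs : LogspaceComputable s) (hf : LogspaceComputable₂ f) :
    LogspaceComputable₂ fun k i => CompiledGames.shiftWire (t k) (d k) (s k) (f k i) :=
  LogspaceComputable₂.ite_lt hf ht.toFst (hf.add hd.toFst) ((hf.add hd.toFst).add hs.toFst)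

/-- The code of a relocated gate. -/
def relocateCode (e : ℕ → ℕ) (c : Fin 4 → ℕ) : Fin 4 → ℕ :=
  ![c 0, if c 0 = 0 then 0 else e (c 1),
    if c 0 = 2 then e (c 2) else if c 0 = 3 then e (c 2) else 0, if c 0 = 3 then e (c 3) else 0]

/-- Kind 2 uses two wires, kind 3 three, and the others one; unused entries must stay 0. Kind 0
encodes no gate but is the default beyond the end of a list. -/
theorem Gate.code_map (e : Fin w ↪ Fin W) (e' : ℕ → ℕ) (he : ∀ i, (e i).val = e' i) (g : Gate w) :
    (g.map e).code = relocateCode e' g.code := by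
  rcases g with (_ | _ | _) | _ | _ | _ <;>
    simp [Gate.map, CGate.map, Gate.code, CGate.code, relocateCode, he]

/-- The code of the inverse gate. -/
def invCode (c : Fin 4 → ℕ) : Fin 4 → ℕ :=
  ![if c 0 = 5 then 6 else if c 0 = 6 then 5 else c 0, c 1, c 2, c 3]

theorem Gate.code_inv (g : Gate w) : g.inv.code = invCode g.code := by
  rcases g with (_ | _ | _) | _ | _ | _ <;>
    simp [Gate.inv, Gate.code, CGate.code, invCode]

theorem LogspaceUniform.relocate {W : ℕ → ℕ} (C : QPTFamily) {t d s : ℕ → ℕ}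
    (ht : LogspaceComputable t) (hd : LogspaceComputable d) (hs : LogspaceComputable s)
    (hW : ∀ k, C.width k + d k + s k ≤ W k) :
    LogspaceUniform fun k => (Circuit.relocate (shiftWires (t k) (d k) (s k) (hW k))
      (C.circuit k)).map Gate.code := by
  have h := C.uniform.map (fun k => relocateCode (shiftWire (t k) (d k) (s k)))
    (fun k => by ext j; fin_cases j <;> simp [relocateCode])
    (fun c hc j => by
      have hz := LogspaceComputable₂.const 0
      have h1 := LogspaceComputable₂.shiftWire ht hd hs (hc 1)
      have h2 := LogspaceComputable₂.shiftWire ht hd hs (hc 2)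
      have h3 := LogspaceComputable₂.shiftWire ht hd hs (hc 3)
      fin_cases j
      · exact hc 0
      · exact LogspaceComputable₂.ite_eq (hc 0) hz hz h1
      · exact LogspaceComputable₂.ite_eq (hc 0) (LogspaceComputable₂.const 2) h2
          (LogspaceComputable₂.ite_eq (hc 0) (LogspaceComputable₂.const 3) h2 hz)
      · exact LogspaceComputable₂.ite_eq (hc 0) (LogspaceComputable₂.const 3) h3 hz)
  convert h using 2 with k
  rw [Circuit.relocate, List.map_map, List.map_map]
  exact List.map_congr_left fun g _ => Gate.code_map _ _ (fun i => shiftWires_val _ _ _ _ i) g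

/-- The family of the inverse circuits. -/
def QPTFamily.inv (C : QPTFamily) : QPTFamily where
  width := C.width
  circuit k := (C.circuit k).inv
  width_logspace := C.width_logspace
  uniform := by
    have h := (C.uniform.map (fun _ => invCode)
      (fun k => by ext j; fin_cases j <;> simp [invCode])
      (fun c hc j => by
        fin_cases j
        · exact LogspaceComputable₂.ite_eq (hc 0) (LogspaceComputable₂.const 5)
            (LogspaceComputable₂.const 6) (LogspaceComputable₂.ite_eq (hc 0)
              (LogspaceComputable₂.const 6) (LogspaceComputable₂.const 5) (hc 0))
        · exact hc 1
        · exact hc 2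
        · exact hc 3)).reverse
    convert h using 2 with k
    rw [Circuit.inv, List.map_reverse, List.map_map, List.map_map]
    congr 1
    exact List.map_congr_left fun g _ => Gate.code_inv g

theorem LogspaceUniform.copyGates {W m p q : ℕ → ℕ} {t s : ℕ → ℕ} (hm : LogspaceComputable m)
    (ht : LogspaceComputable t) (hp : LogspaceComputable p) (hs : LogspaceComputable s)
    (hq : LogspaceComputable q) (f g : ∀ k, Fin (m k) → Fin (W k))
    (hf : ∀ k i, (f k i).val = shiftWire (t k) (p k) (s k) i)
    (hg : ∀ k i, (g k i).val = q k + i) (h : ∀ k i j, f k i ≠ g k j) :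
    LogspaceUniform fun k => ((CompiledGames.copyGates (f k) (g k) (h k)).map Gate.cl).map
      Gate.code := by
  have := LogspaceUniform.ofFn hm
    ![fun _ _ => 2, fun k i => shiftWire (t k) (p k) (s k) i, fun k i => q k + i, fun _ _ => 0]
    (fun j => by
      fin_cases j
      · exact LogspaceComputable₂.const 2
      · exact LogspaceComputable₂.shiftWire ht hp hs logspaceComputable₂_snd
      · exact hq.toFst.add logspaceComputable₂_snd
      · exact LogspaceComputable₂.const 0)
  convert this using 2 with k
  rw [CompiledGames.copyGates, List.map_ofFn, List.map_ofFn]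
  congr 1
  ext i j
  fin_cases j <;> simp [Gate.code, CGate.code, hf, hg]

theorem LogspaceUniform.measureGates {W m t d s q : ℕ → ℕ} (C : QPTFamily)
    (hm : LogspaceComputable m) (ht : LogspaceComputable t) (hd : LogspaceComputable d)
    (hs : LogspaceComputable s) (hq : LogspaceComputable q)
    (hmw : ∀ k, m k ≤ C.width k) (hW : ∀ k, C.width k + d k + s k ≤ W k)
    (g : ∀ k, Fin (m k) → Fin (W k)) (hg : ∀ k i, (g k i).val = q k + i)
    (heg : ∀ k i j, shiftWires (t k) (d k) (s k) (hW k) i ≠ g k j) :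
    LogspaceUniform fun k => (CompiledGames.measureGates (hmw k)
      (shiftWires (t k) (d k) (s k) (hW k)) (g k) (heg k) (C.circuit k)).map Gate.code := by
  simp only [CompiledGames.measureGates, List.map_append]
  exact (LogspaceUniform.relocate C ht hd hs hW).append
    ((LogspaceUniform.copyGates hm ht hd hs hq
      (fun k i => shiftWires (t k) (d k) (s k) (hW k) (Fin.castLE (hmw k) i)) g
      (fun _ _ => rfl) hg fun k _ _ => heg k _ _).append
      (LogspaceUniform.relocate C.inv ht hd hs hW))

/-! ### The circuit that plays against an encrypted question -/

section Layout

variable {IB : Type*} {h l m A wψ wp wu : ℕ} {wb : IB → ℕ}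

/-- The register of the strategy occupies the `h` wires from `l + 1` on. -/
def registerWires (h l : ℕ) (hW : h + (l + 1) ≤ W) : Fin h ↪ Fin W where
  toFun r := ⟨r + (l + 1), by have := r.2; omega⟩
  inj' r r' hr := by
    have := congrArg Fin.val hr
    ext
    simpa using this

/-- The relocated circuits skip different blocks, but the skipped wires lie beyond the register, so
all of them act on the same register wires. -/
theorem initialWires_trans_shiftWires {t s : ℕ} (hw : h ≤ w) (hW : w + (l + 1) + s ≤ W)
    (ht : h ≤ t ∨ s = 0) :
    (initialWires hw).trans (shiftWires t (l + 1) s hW) = registerWires h l (by omega) := by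
  ext r
  change shiftWire t (l + 1) s r.val = r.val + (l + 1)
  have := r.2
  unfold shiftWire
  split_ifs <;> omega

/-- The contents of the wires other than the register: the output wire `0`, the challenge, the
reply, and zeros. -/
def background (W h : ℕ) {l m : ℕ} (o : Bool) (c : Bits l) (α : Bits m) : Bits W := fun j =>
  if j.val = 0 then o else if j.val < l + 1 + h then false
  else if j.val < l + 1 + h + l then c.bit (j - (l + 1 + h)) else α.bit (j - (l + 1 + h + l))

theorem Bits.bit_of_le {z : Bits w} {i : ℕ} (h : w ≤ i) : z.bit i = false := by
  rw [Bits.bit, dif_neg (by omega)]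

theorem Bits.bit_of_lt {z : Bits w} {i : ℕ} (h : i < w) : z.bit i = z ⟨i, h⟩ := by
  rw [Bits.bit, dif_pos h]

/-- The shift decides what a circuit sees after the register. Skipping challenge and reply shows
only zeros, as state preparation and Bob's measurements require. Skipping only the reply serves
Alice's measurement, and skipping nothing serves her unitary. -/
theorem background_ancilla (o : Bool) (c : Bits l) (α : Bits m) (hW : w + (l + 1) + (l + m) ≤ W)
    (r : Fin w) (hr : h ≤ r) (v : Bits 0) :
    background W h o c α (shiftWires h (l + 1) (l + m) hW r) = v.bit (r - h) := by
  have h1 := shiftWires_val h (l + 1) (l + m) hW r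
  rw [shiftWire, if_neg (by omega)] at h1
  rw [background, if_neg (by omega), if_neg (by omega), if_neg (by omega),
    Bits.bit_of_le (by omega), Bits.bit_of_le (by omega)]

theorem background_challenge (o : Bool) (c : Bits l) (α : Bits m) (hW : w + (l + 1) + m ≤ W)
    (r : Fin w) (hr : h ≤ r) :
    background W h o c α (shiftWires (h + l) (l + 1) m hW r) = c.bit (r - h) := by
  have h1 := shiftWires_val (h + l) (l + 1) m hW r
  unfold shiftWire at h1
  split_ifs at h1
  · rw [background, if_neg (by omega), if_neg (by omega), if_pos (by omega), h1]
    congr 1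
    omega
  · rw [background, if_neg (by omega), if_neg (by omega), if_neg (by omega),
      Bits.bit_of_le (by omega), Bits.bit_of_le (by omega)]

theorem background_reply (o : Bool) (c : Bits l) (α : Bits m) (hW : w + (l + 1) + 0 ≤ W)
    (r : Fin w) (hr : h ≤ r) :
    background W h o c α (shiftWires 0 (l + 1) 0 hW r) =
      Bits.bit (w := l + m) (Fin.append c α) (r - h) := by
  have h1 := shiftWires_val 0 (l + 1) 0 hW r
  rw [shiftWire, if_neg (by omega)] at h1
  rw [background, if_neg (by omega), if_neg (by omega), h1]
  split_ifs
  · rw [Bits.bit_append_left c α (by omega), Bits.bit_of_lt (by omega)]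
    congr 2
    omega
  · rw [Bits.bit_append_right c α (by omega)]
    congr 1
    omega

/-- The wires that receive the challenge. -/
def challengeWires (h l : ℕ) (hW : l + 1 + h + l ≤ W) (i : Fin l) : Fin W :=
  ⟨l + 1 + h + i, by omega⟩

/-- The wires that receive the reply. -/
def replyWires (h l m : ℕ) (hW : l + 1 + h + l + m ≤ W) (i : Fin m) : Fin W :=
  ⟨l + 1 + h + l + i, by omega⟩

theorem background_replyWires (hW : l + 1 + h + l + m ≤ W) (o : Bool) (c : Bits l) (α : Bits m)
    (i : Fin m) : background W h o c α (replyWires h l m hW i) = α i := by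
  have hi : (replyWires h l m hW i).val = l + 1 + h + l + i := rfl
  rw [background, if_neg (by omega), if_neg (by omega), if_neg (by omega),
    Bits.bit_of_lt (by omega)]
  congr 1
  ext
  simp [hi]

/-- Move the challenge from the first wires to its place. -/
def moveGates (h l : ℕ) (hW : l + 1 + h + l ≤ W) : List (CGate W) :=
  copyGates (fun i : Fin l => (⟨i, by omega⟩ : Fin W)) (challengeWires h l hW)
      (fun i j e => by have := congrArg Fin.val e; simp only [challengeWires] at this; omega) ++
    copyGates (challengeWires h l hW) (fun i : Fin l => (⟨i, by omega⟩ : Fin W))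
      (fun i j e => by have := congrArg Fin.val e; simp only [challengeWires] at this; omega)

theorem actList_append (L L' : List (CGate W)) (z : Bits W) :
    actList (L ++ L') z = actList L' (actList L z) := List.foldl_append

theorem actList_injective (L : List (CGate W)) : Function.Injective (actList L) := by
  induction L with
  | nil => exact fun _ _ h => h
  | cons g L ih =>
    intro z z' hz
    have := ih (a₁ := g.act z) (a₂ := g.act z') hz
    rw [← g.act_act z, this, g.act_act]

/-- The challenge arrives on the first wires, but wire 0 has to carry the output. Copying the
challenge away and xoring it back clears those wires. -/
theorem moveGates_act (hW : l + 1 + h + l ≤ W) (c : Bits l) :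
    actList (moveGates h l hW) (c.resize W) = background W h false c (fun _ : Fin m => false) := by
  rw [moveGates, actList_append]
  obtain ⟨h1, h2⟩ := copyGates_act (fun i : Fin l => (⟨i, by omega⟩ : Fin W))
    (challengeWires h l hW)
    (fun i j e => by have := congrArg Fin.val e; simp only [challengeWires] at this; omega)
    (fun i j e => by have := congrArg Fin.val e; simp only [challengeWires] at this; ext; omega)
    (c.resize W)
  set z1 := actList (copyGates (fun i : Fin l => (⟨i, by omega⟩ : Fin W))
    (challengeWires h l hW) _) (c.resize W)
  obtain ⟨h3, h4⟩ := copyGates_act (challengeWires h l hW)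
    (fun i : Fin l => (⟨i, by omega⟩ : Fin W))
    (fun i j e => by have := congrArg Fin.val e; simp only [challengeWires] at this; omega)
    (fun i j e => by have := congrArg Fin.val e; ext; simpa using this) z1
  have hc : ∀ i, z1 (challengeWires h l hW i) = c i := fun i => by
    rw [h1, Bits.resize, Bits.bit_of_le (by simp only [challengeWires]; omega), Bool.false_xor,
      Bits.resize, Bits.bit_of_lt i.2]
  have hc' : ∀ i : Fin l, z1 ⟨i, by omega⟩ = c i := fun i => by
    rw [h2 _ fun j e => by have := congrArg Fin.val e; simp only [challengeWires] at this; omega,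
      Bits.resize, Bits.bit_of_lt i.2]
  ext j
  by_cases hj : j.val < l
  · have := h3 ⟨j, hj⟩
    rw [hc, hc'] at this
    refine this.trans ?_
    rw [Bool.xor_self, background]
    split_ifs <;> first | rfl | omega
  rw [h4 j fun i e => by have := congrArg Fin.val e; simp only at this; omega]
  by_cases hj2 : l + 1 + h ≤ j.val ∧ j.val < l + 1 + h + l
  · have : j = challengeWires h l hW ⟨j - (l + 1 + h), by omega⟩ := by
      ext; simp only [challengeWires]; omega
    rw [background, if_neg (by omega), if_neg (by omega), if_pos hj2.2, Bits.bit_of_lt (by omega),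
      ← hc, ← this]
  · rw [h2 j fun i e => by
      have := congrArg Fin.val e; simp only [challengeWires] at this; omega, Bits.resize,
      Bits.bit_of_le (by omega), background]
    split_ifs
    · rfl
    · rfl
    · omega
    · unfold Bits.bit
      split_ifs <;> rfl

theorem moveGates_mulVec (hW : l + 1 + h + l ≤ W) (c : Bits l) :
    Circuit.mat ((moveGates h l hW).map Gate.cl) *ᵥ Pi.single (c.resize W) 1 =
      Pi.single (background W h false c (fun _ : Fin m => false)) 1 := by
  refine mat_classical_mulVec _ _ _ fun z => ?_
  rw [← moveGates_act hW]
  simp only [Pi.single_apply, (actList_injective (moveGates h l hW)).eq_iff]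

theorem lift_single (e : Fin w ↪ Fin W) (bg : Bits W) :
    lift e bg (Pi.single (fun i => bg (e i)) 1) = Pi.single bg 1 := by
  ext z
  simp only [lift, Pi.single_apply, ← ite_and]
  refine if_congr ?_ rfl rfl
  constructor
  · rintro ⟨h1, h2⟩
    ext j
    by_cases hj : ∃ i, e i = j
    · obtain ⟨i, rfl⟩ := hj
      exact congrFun h2 i
    · push Not at hj
      exact h1 j hj
  · rintro rfl
    exact ⟨fun _ _ => rfl, rfl⟩

/-- Measure Bob's observables for a list of questions and xor the outcomes into wire `0`. -/
def bobGates (h l m : ℕ) (Cb : ∀ y, Circuit (wb y)) (hb : ∀ y, wb y + (l + 1) + (l + m) ≤ W)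
    (hb1 : ∀ y, 1 ≤ wb y) : List IB → Circuit W
  | [] => []
  | y :: ys => measureGates (hb1 y) (shiftWires h (l + 1) (l + m) (hb y))
      -- The form `0 + i` matches the offset `q k + i` in `LogspaceUniform.measureGates`.
      (fun i : Fin 1 => (⟨0 + i, by have := hb y; omega⟩ : Fin W))
      (fun i j e => by
        have := congrArg Fin.val e
        simp only [shiftWires_val, shiftWire] at this
        split_ifs at this <;> omega) (Cb y) ++ bobGates h l m Cb hb hb1 ys

/-- The product of observables; the head of the list acts first. -/
def obsProd {ι : Type*} [Fintype ι] [DecidableEq ι] (O : IB → Matrix ι ι ℂ) :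
    List IB → Matrix ι ι ℂ
  | [] => 1
  | y :: ys => obsProd O ys * O y

theorem lift_add (e : Fin w ↪ Fin W) (bg : Bits W) (φ φ' : Bits w → ℂ) :
    lift e bg (φ + φ') = lift e bg φ + lift e bg φ' := by
  ext z
  simp only [lift, Pi.add_apply]
  split_ifs <;> simp

theorem background_xor (c : Bits l) (α : Bits m) (o b : Bool) :
    (∀ j : Fin W, j.val = 0 → background W h (xor o b) c α j = xor (background W h o c α j) b) ∧
      ∀ j : Fin W, j.val ≠ 0 → background W h (xor o b) c α j = background W h o c α j := by
  refine ⟨fun j hj => ?_, fun j hj => ?_⟩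
  · simp [background, hj]
  · simp [background, hj]

/-- The outcomes are not recorded separately, so branches with the same parity interfere. Measuring
one more question replaces `Y` by `(B_{y0} - B_{y1}) Y` in the branches `(v ± Y v) / 2`. With
separate records one would get the statistics of sequential measurements instead of the product of
observables. -/
theorem bobGates_mulVec (Cb : ∀ y, Circuit (wb y)) (hb : ∀ y, wb y + (l + 1) + (l + m) ≤ W)
    (hb1 : ∀ y, 1 ≤ wb y) (hbh : ∀ y, h ≤ wb y) (hW : h + (l + 1) ≤ W)
    (B : IB → Bool → Matrix (Bits h) (Bits h) ℂ) (hB : ∀ y, IsPVM (B y))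
    (hC : ∀ y (α : Bits 1), (Cb y).effect h (Fin.elim0 : Bits 0) α = B y (α 0)) (ys : List IB)
    (c : Bits l) (α : Bits m) (Y : Matrix (Bits h) (Bits h) ℂ) (v : Bits h → ℂ) :
    (bobGates h l m Cb hb hb1 ys).mat *ᵥ ∑ o : Bool, lift (registerWires h l hW)
      (background W h o c α) ((1 / 2 : ℂ) • (v + sgn o • (Y *ᵥ v))) =
    ∑ o : Bool, lift (registerWires h l hW) (background W h o c α)
      ((1 / 2 : ℂ) • (v + sgn o • ((obsProd (fun y => B y false - B y true) ys * Y) *ᵥ v))) := by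
  induction ys generalizing Y with
  | nil => simp [bobGates, Circuit.mat, obsProd]
  | cons y ys ih =>
    have key : ∀ (o : Bool) (u : Bits h → ℂ),
        (measureGates (hb1 y) (shiftWires h (l + 1) (l + m) (hb y))
        (fun i : Fin 1 => (⟨0 + i, by have := hb y; omega⟩ : Fin W))
        (fun i j e => by
          have := congrArg Fin.val e
          simp only [shiftWires_val, shiftWire] at this
          split_ifs at this <;> omega) (Cb y)).mat *ᵥ
          lift (registerWires h l hW) (background W h o c α) u =
        ∑ b : Bool, lift (registerWires h l hW) (background W h (xor o b) c α) (B y b *ᵥ u) := by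
      intro o u
      rw [← initialWires_trans_shiftWires (hbh y) (hb y) (Or.inl le_rfl)]
      rw [measureGates_mulVec (hbh y) (hb1 y) _ _
        (fun i j e => Subsingleton.elim _ _) _ _ (Fin.elim0 : Bits 0)
        (fun β => by rw [hC]; exact (hB y).isStarProjection _) _
        (fun β => background W h (xor o (β 0)) c α)
        (fun β i => by
          rw [(background_xor c α o (β 0)).1 _ (by simp), Subsingleton.elim i 0])
        (fun β j hj => (background_xor c α o (β 0)).2 _ fun h0 => hj 0 (by
          ext; simpa using h0.symm)) u
        (fun r hr => background_ancilla o c α (hb y) r hr _)]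
      refine Fintype.sum_equiv (Equiv.funUnique (Fin 1) Bool) _ _ fun β => ?_
      rw [hC]
      rfl
    rw [bobGates, Circuit.mat_append, ← Matrix.mulVec_mulVec, Matrix.mulVec_sum, obsProd,
      Matrix.mul_assoc, ← ih]
    congr 1
    simp_rw [key]
    have hsum := (hB y).sum_eq_one
    simp only [Fintype.sum_bool, Bool.xor_true, Bool.xor_false, Bool.not_true, Bool.not_false,
      sgn] at hsum ⊢
    have e1 : v = B y true *ᵥ v + B y false *ᵥ v := by
      rw [← Matrix.add_mulVec, hsum, Matrix.one_mulVec]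
    have e2 : ((B y false - B y true) * Y) *ᵥ v = B y false *ᵥ (Y *ᵥ v) - B y true *ᵥ (Y *ᵥ v) := by
      rw [← Matrix.mulVec_mulVec, Matrix.sub_mulVec]
    -- The new branch 0 collects the pairs with old parity equal to the new outcome; `e4` collects
    -- the unequal pairs for branch 1.
    have e3 : (1 / 2 : ℂ) • (v + (1 : ℂ) • ((B y false - B y true) * Y) *ᵥ v) =
        B y true *ᵥ ((1 / 2 : ℂ) • (v + (-1 : ℂ) • Y *ᵥ v)) +
          B y false *ᵥ ((1 / 2 : ℂ) • (v + (1 : ℂ) • Y *ᵥ v)) := by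
      rw [e2]
      nth_rewrite 1 [e1]
      simp only [Matrix.mulVec_smul, Matrix.mulVec_add]
      module
    have e4 : (1 / 2 : ℂ) • (v + (-1 : ℂ) • ((B y false - B y true) * Y) *ᵥ v) =
        B y false *ᵥ ((1 / 2 : ℂ) • (v + (-1 : ℂ) • Y *ᵥ v)) +
          B y true *ᵥ ((1 / 2 : ℂ) • (v + (1 : ℂ) • Y *ᵥ v)) := by
      rw [e2]
      nth_rewrite 1 [e1]
      simp only [Matrix.mulVec_smul, Matrix.mulVec_add]
      module
    simp only [if_true, Bool.false_eq_true, if_false]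
    rw [e3, e4, lift_add, lift_add]
    abel

/-- Prepare the state, measure and apply the unitary for the challenge on the first wires, and
measure Bob's observables. -/
def proverCircuit (h l m : ℕ) (hW : l + 1 + h + l + m ≤ W)
    (Cψ : Circuit wψ) (hψ : wψ + (l + 1) + (l + m) ≤ W)
    (Cp : Circuit wp) (hp : wp + (l + 1) + m ≤ W) (hmp : m ≤ wp)
    (Cu : Circuit wu) (hu : wu + (l + 1) + 0 ≤ W)
    (Cb : ∀ y, Circuit (wb y)) (hb : ∀ y, wb y + (l + 1) + (l + m) ≤ W) (hb1 : ∀ y, 1 ≤ wb y)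
    (ys : List IB) : Circuit W :=
  (moveGates h l (by omega)).map Gate.cl ++
    (Circuit.relocate (shiftWires h (l + 1) (l + m) hψ) Cψ ++
    (measureGates hmp (shiftWires (h + l) (l + 1) m hp) (replyWires h l m hW)
      (fun i j e => by
        have := congrArg Fin.val e
        simp only [shiftWires_val, shiftWire, replyWires] at this
        split_ifs at this <;> omega) Cp ++
    (Circuit.relocate (shiftWires 0 (l + 1) 0 hu) Cu ++ bobGates h l m Cb hb hb1 ys)))

/-- The reply wires retain `α`, so the branches for different replies remain orthogonal, as after a
genuine measurement. -/
theorem proverCircuit_mulVec (hW : l + 1 + h + l + m ≤ W)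
    (Cψ : Circuit wψ) (hψ : wψ + (l + 1) + (l + m) ≤ W)
    (Cp : Circuit wp) (hp : wp + (l + 1) + m ≤ W) (hmp : m ≤ wp)
    (Cu : Circuit wu) (hu : wu + (l + 1) + 0 ≤ W)
    (Cb : ∀ y, Circuit (wb y)) (hb : ∀ y, wb y + (l + 1) + (l + m) ≤ W) (hb1 : ∀ y, 1 ≤ wb y)
    (ys : List IB) (hhψ : h ≤ wψ) (hhp : h ≤ wp) (hhu : h ≤ wu) (hhb : ∀ y, h ≤ wb y)
    (c : Bits l) (ψ : Bits h → ℂ) (P U : Bits m → Matrix (Bits h) (Bits h) ℂ)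
    (B : IB → Bool → Matrix (Bits h) (Bits h) ℂ)
    (hCψ : Cψ.mat *ᵥ Pi.single (fun _ => false) 1 = load wψ h (Fin.elim0 : Bits 0) *ᵥ ψ)
    (hP : IsPVM P) (hCp : ∀ α, Cp.effect h c α = P α)
    (hCu : ∀ α, Cu.mat * load wu h (Fin.append c α : Bits (l + m)) =
      load wu h (Fin.append c α : Bits (l + m)) * U α)
    (hB : ∀ y, IsPVM (B y))
    (hCb : ∀ y (α : Bits 1), (Cb y).effect h (Fin.elim0 : Bits 0) α = B y (α 0)) :
    (proverCircuit h l m hW Cψ hψ Cp hp hmp Cu hu Cb hb hb1 ys).mat *ᵥ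
        Pi.single (c.resize W) 1 =
      ∑ α, ∑ o : Bool, lift (registerWires h l (by omega)) (background W h o c α)
        ((1 / 2 : ℂ) • ((U α * P α) *ᵥ ψ +
          sgn o • (obsProd (fun y => B y false - B y true) ys *ᵥ ((U α * P α) *ᵥ ψ)))) := by
  have s1 : Pi.single (background W h false c (fun _ : Fin m => false)) (1 : ℂ) =
      lift (shiftWires h (l + 1) (l + m) hψ) (background W h false c (fun _ : Fin m => false))
        (Pi.single (fun _ => false) 1) := by
    rw [← lift_single (shiftWires h (l + 1) (l + m) hψ)]
    congr 2
    ext r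
    by_cases hr : h ≤ r.val
    · rw [background_ancilla _ _ _ hψ r hr Fin.elim0, Bits.bit_of_le (by omega)]
    · have := shiftWires_val h (l + 1) (l + m) hψ r
      rw [shiftWire, if_pos (by omega)] at this
      rw [background, if_neg (by omega), if_pos (by omega)]
  have s2 := lift_load hhψ (shiftWires h (l + 1) (l + m) hψ)
    (background W h false c (fun _ : Fin m => false)) (Fin.elim0 : Bits 0) ψ
    (fun r hr => background_ancilla _ _ _ hψ r hr _)
  rw [initialWires_trans_shiftWires hhψ hψ (Or.inl le_rfl)] at s2
  have s3 := measureGates_mulVec hhp hmp (shiftWires (h + l) (l + 1) m hp) (replyWires h l m hW)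
    (fun i j e => by have := congrArg Fin.val e; simp only [replyWires] at this; ext; omega)
    (fun i j e => by
      have := congrArg Fin.val e
      simp only [shiftWires_val, shiftWire, replyWires] at this
      split_ifs at this <;> omega) Cp c
    (fun α => by rw [hCp]; exact hP.isStarProjection α)
    (background W h false c (fun _ : Fin m => false)) (fun α => background W h false c α)
    (fun α i => by
      rw [background_replyWires, background_replyWires, Bool.false_xor])
    (fun α j hj => by
      simp only [background]
      split_ifs
      · rfl
      · rfl
      · rfl
      · by_cases hjm : j.val - (l + 1 + h + l) < m
        · refine absurd ?_ (hj ⟨_, hjm⟩)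
          ext
          simp only [replyWires]
          omega
        · rw [Bits.bit_of_le (by omega), Bits.bit_of_le (by omega)]) ψ
    (fun r hr => background_challenge _ _ _ hp r hr)
  rw [initialWires_trans_shiftWires hhp hp (Or.inl (by omega))] at s3
  have s4 : ∀ (α : Bits m) (u : Bits h → ℂ),
      (Circuit.relocate (shiftWires 0 (l + 1) 0 hu) Cu).mat *ᵥ
        lift (registerWires h l (by omega)) (background W h false c α) u =
      lift (registerWires h l (by omega)) (background W h false c α) (U α *ᵥ u) := by
    intro α u
    have := fun u => lift_load hhu (shiftWires 0 (l + 1) 0 hu) (background W h false c α)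
      (Fin.append c α : Bits (l + m)) u (fun r hr => background_reply _ _ _ hu r hr)
    simp only [initialWires_trans_shiftWires hhu hu (Or.inr rfl)] at this
    rw [← this, ← this, Circuit.relocate_mulVec_lift, Matrix.mulVec_mulVec, hCu,
      Matrix.mulVec_mulVec]
  -- Before Bob's part the output wire is 0, which is the invariant of `bobGates_mulVec` with `Y =
  -- 1`.
  have s5 : ∀ (α : Bits m) (u : Bits h → ℂ),
      lift (registerWires h l (by omega)) (background W h false c α) u =
      ∑ o : Bool, lift (registerWires h l (by omega)) (background W h o c α)
        ((1 / 2 : ℂ) • (u + sgn o • ((1 : Matrix (Bits h) (Bits h) ℂ) *ᵥ u))) := by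
    intro α u
    have e1 : (1 / 2 : ℂ) • (u + (1 : ℂ) • u) = u := by module
    have e2 : (1 / 2 : ℂ) • (u + (-1 : ℂ) • u) = 0 := by module
    have e3 : ∀ bg, lift (registerWires h l (W := W) (by omega)) bg 0 = 0 := fun bg => by
      ext z; simp [lift]
    simp only [Fintype.sum_bool, sgn, Matrix.one_mulVec, if_true, Bool.false_eq_true, if_false, e1,
      e2, e3, zero_add]
  rw [proverCircuit, Circuit.mat_append, Circuit.mat_append, Circuit.mat_append,
    Circuit.mat_append]
  simp only [← Matrix.mulVec_mulVec]
  rw [moveGates_mulVec (m := m), s1, Circuit.relocate_mulVec_lift, hCψ, s2, s3, Matrix.mulVec_sum,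
    Matrix.mulVec_sum]
  refine Finset.sum_congr rfl fun α _ => ?_
  rw [s4, s5, bobGates_mulVec Cb hb hb1 hhb (by omega) B hB hCb, hCp]
  simp only [Matrix.mul_one, Matrix.mulVec_mulVec]

end Layout

end CompiledGames

namespace CompiledGames

variable {w W : ℕ}

/-! ### Acceptance probability of an adversary without oracle queries -/

/-- Without oracle queries the density matrix stays pure, whatever the oracle distribution `p`. -/
theorem foldl_step_gates {n l : ℕ} (p : Bits n → Bits l → ℝ) (C : Circuit w) (φ : Bits w → ℂ) :
    (C.map (QHE.OGate.gate (n := n) (l := l))).foldl (fun ρ g => g.step p ρ)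
      (Matrix.vecMulVec φ (star φ)) =
        Matrix.vecMulVec (C.mat *ᵥ φ) (star (C.mat *ᵥ φ)) := by
  induction C generalizing φ with
  | nil => simp [Circuit.mat]
  | cons g C ih =>
    rw [List.map_cons, List.foldl_cons, Circuit.mat, ← Matrix.mulVec_mulVec, ← ih]
    congr 1
    rw [QHE.OGate.step, Matrix.mul_vecMulVec, Matrix.vecMulVec_mul, Matrix.star_mulVec]

theorem lift_background_eq {h l m : ℕ} (hW : h + (l + 1) ≤ W) (o : Bool) (c : Bits l)
    (α : Bits m) (φ : Bits h → ℂ) (z : Bits W) (hz : z.bit 0 ≠ o) :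
    lift (registerWires h l hW) (background W h o c α) φ z = 0 := by
  rw [lift, if_neg]
  intro hall
  have := hall ⟨0, by omega⟩ fun i hi => by
    have := congrArg Fin.val hi
    simp [registerWires] at this
  rw [Bits.bit_of_lt (by omega), this] at hz
  simp [background] at hz

/-- The output bit selects the branches with `o = true`. Distinct replies differ on a reply wire, so
cross terms vanish. -/
theorem sum_accepting {h l m : ℕ} (hW : l + 1 + h + l + m ≤ W) (c : Bits l)
    (φ : Bits m → Bool → Bits h → ℂ) (Φ : Bits W → ℂ)
    (hΦ : Φ = ∑ α, ∑ o : Bool, lift (registerWires h l (by omega)) (background W h o c α) (φ α o)) :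
    (∑ z : Bits W, if z.bit 0 then Matrix.vecMulVec Φ (star Φ) z z else 0) =
      ∑ α, star (φ α true) ⬝ᵥ φ α true := by
  set Ψ : Bits W → ℂ :=
    ∑ α, lift (registerWires h l (by omega)) (background W h true c α) (φ α true) with hΨ
  have h1 : ∀ z : Bits W, Ψ z = if z.bit 0 then Φ z else 0 := by
    intro z
    rw [hΨ, hΦ, Finset.sum_apply, Finset.sum_apply]
    split_ifs with hz
    · refine Finset.sum_congr rfl fun α _ => ?_
      rw [Finset.sum_apply, Fintype.sum_bool,
        lift_background_eq (by omega) false c α _ z (by simp [hz]), add_zero]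
    · exact Finset.sum_eq_zero fun α _ =>
        lift_background_eq (by omega) true c α _ z (by simpa using hz)
  have h2 : (∑ z : Bits W, if z.bit 0 then Matrix.vecMulVec Φ (star Φ) z z else 0) =
      star Ψ ⬝ᵥ Ψ := by
    refine Finset.sum_congr rfl fun z _ => ?_
    rw [Pi.star_apply, h1]
    split_ifs
    · rw [Matrix.vecMulVec_apply, Pi.star_apply, mul_comm]
    · simp
  rw [h2, hΨ, star_sum, sum_dotProduct]
  refine Finset.sum_congr rfl fun α _ => ?_
  rw [dotProduct_sum, Finset.sum_eq_single α, lift_inner]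
  · intro α' _ hα
    obtain ⟨i, hi⟩ := Function.ne_iff.1 hα
    refine lift_inner_of_ne _ (j := replyWires h l m hW i) (fun r hr => ?_) ?_ _ _
    · have : r.val + (l + 1) = l + 1 + h + l + i := congrArg Fin.val hr
      omega
    · rw [background_replyWires, background_replyWires]
      exact hi.symm
  · simp

/-- `X` need not be self-adjoint, since it is a product of observables. The two cross terms are
conjugate, so only the real part of the moment appears. -/
theorem re_inner_half_sub {ι : Type*} [Fintype ι] [DecidableEq ι] (X : Matrix ι ι ℂ)
    (hX : Xᴴ * X = 1) (v : ι → ℂ) :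
    (star ((1 / 2 : ℂ) • (v + sgn true • (X *ᵥ v))) ⬝ᵥ
      ((1 / 2 : ℂ) • (v + sgn true • (X *ᵥ v)))).re =
        ((star v ⬝ᵥ v).re - (star v ⬝ᵥ (X *ᵥ v)).re) / 2 := by
  have h1 : star (X *ᵥ v) ⬝ᵥ (X *ᵥ v) = star v ⬝ᵥ v := by
    rw [Matrix.star_mulVec, ← Matrix.dotProduct_mulVec, Matrix.mulVec_mulVec, hX,
      Matrix.one_mulVec]
  have h2 : star (X *ᵥ v) ⬝ᵥ v = star (star v ⬝ᵥ (X *ᵥ v)) :=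
    Matrix.star_dotProduct _ _
  simp only [sgn, if_true, star_smul, star_add, smul_dotProduct, dotProduct_smul, add_dotProduct,
    dotProduct_add, h1, h2]
  have h3 : star (1 / 2 : ℂ) = 1 / 2 := by simp
  have h4 : star (-1 : ℂ) = -1 := by simp
  rw [h3, h4]
  simp only [smul_eq_mul]
  generalize star v ⬝ᵥ v = a, star v ⬝ᵥ (X *ᵥ v) = b
  have h5 : (1 / 2 * (1 / 2 * (a + -1 * star b) + -1 * (1 / 2 * (b + -1 * a))) : ℂ) =
      ((1 / 4 : ℝ) : ℂ) * (2 * a - star b - b) := by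
    push_cast
    ring
  rw [h5, Complex.re_ofReal_mul]
  simp only [Complex.sub_re, Complex.star_def, Complex.conj_re, Complex.mul_re, Complex.re_ofNat,
    Complex.im_ofNat]
  ring

theorem IsPVM.conjTranspose_obs {ι : Type*} [Fintype ι] [DecidableEq ι] {P : Bool → Matrix ι ι ℂ}
    (h : IsPVM P) : (P false - P true)ᴴ = P false - P true := by
  have h1 : (P false)ᴴ = P false := (h.isStarProjection false).isSelfAdjoint
  have h2 : (P true)ᴴ = P true := (h.isStarProjection true).isSelfAdjoint
  rw [Matrix.conjTranspose_sub, h1, h2]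

theorem obsProd_unitary {IB ι : Type*} [Fintype ι] [DecidableEq ι]
    {B : IB → Bool → Matrix ι ι ℂ} (hB : ∀ y, IsPVM (B y)) (ys : List IB) :
    (obsProd (fun y => B y false - B y true) ys)ᴴ *
      obsProd (fun y => B y false - B y true) ys = 1 := by
  induction ys with
  | nil => simp [obsProd]
  | cons y ys ih =>
    rw [obsProd, Matrix.conjTranspose_mul, Matrix.mul_assoc, ← Matrix.mul_assoc _ _ (_ - _), ih,
      Matrix.one_mul, (hB y).conjTranspose_obs, (hB y).sq_sub]

/-! ### Logspace uniformity of the adversary's circuit -/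

theorem LogspaceComputable.sum {ι : Type*} (s : Finset ι) {f : ι → ℕ → ℕ}
    (hf : ∀ i, LogspaceComputable (f i)) : LogspaceComputable fun k => ∑ i ∈ s, f i k := by
  classical
  induction s using Finset.induction_on with
  | empty => simpa using LogspaceComputable.const 0
  | insert i s hi ih => simpa [Finset.sum_insert hi] using (hf i).add ih

section Uniform

variable {IB : Type*}

/-- The list `ys` does not depend on the security parameter, so a fixed number of uniform families
is concatenated. -/
theorem LogspaceUniform.bobGates {W h l m : ℕ → ℕ} (Cb : IB → QPTFamily)
    (hh : LogspaceComputable h) (hl : LogspaceComputable l) (hm : LogspaceComputable m)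
    (hb : ∀ k y, (Cb y).width k + (l k + 1) + (l k + m k) ≤ W k)
    (hb1 : ∀ k y, 1 ≤ (Cb y).width k) (ys : List IB) :
    LogspaceUniform fun k => (CompiledGames.bobGates (h k) (l k) (m k)
      (fun y => (Cb y).circuit k) (hb k) (hb1 k) ys).map Gate.code := by
  induction ys with
  | nil => exact LogspaceUniform.nil
  | cons y ys ih =>
    simp only [CompiledGames.bobGates, List.map_append]
    exact (LogspaceUniform.measureGates (Cb y) (LogspaceComputable.const 1) hh
      (hl.add (LogspaceComputable.const 1)) (hl.add hm) (LogspaceComputable.const 0) _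
      (fun k => hb k y) _ (fun _ _ => rfl) _).append ih

theorem LogspaceUniform.moveGates {W h l : ℕ → ℕ} (hh : LogspaceComputable h)
    (hl : LogspaceComputable l) (hW : ∀ k, l k + 1 + h k + l k ≤ W k) :
    LogspaceUniform fun k => ((CompiledGames.moveGates (h k) (l k) (hW k)).map Gate.cl).map
      Gate.code := by
  have h0 := LogspaceComputable.const 0
  have hd := (hl.add (LogspaceComputable.const 1)).add hh
  simp only [CompiledGames.moveGates, List.map_append]
  refine (LogspaceUniform.copyGates hl h0 h0 h0 hd (fun k (i : Fin (l k)) =>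
    (⟨i, by have := hW k; omega⟩ : Fin (W k))) (fun k => challengeWires (h k) (l k) (hW k))
    (fun k i => by simp [shiftWire]) (fun _ _ => rfl) _).append
    (LogspaceUniform.copyGates hl h0 hd h0 h0 (fun k => challengeWires (h k) (l k) (hW k))
    (fun k (i : Fin (l k)) => (⟨i, by have := hW k; omega⟩ : Fin (W k)))
    (fun k i => by simp [shiftWire, challengeWires, add_comm]) (fun k i => by simp) _)

theorem LogspaceUniform.proverCircuit {W h l m : ℕ → ℕ} (hh : LogspaceComputable h)
    (hl : LogspaceComputable l) (hm : LogspaceComputable m)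
    (hW : ∀ k, l k + 1 + h k + l k + m k ≤ W k)
    (Cψ Cp Cu : QPTFamily) (Cb : IB → QPTFamily)
    (hψ : ∀ k, Cψ.width k + (l k + 1) + (l k + m k) ≤ W k)
    (hp : ∀ k, Cp.width k + (l k + 1) + m k ≤ W k) (hmp : ∀ k, m k ≤ Cp.width k)
    (hu : ∀ k, Cu.width k + (l k + 1) + 0 ≤ W k)
    (hb : ∀ k y, (Cb y).width k + (l k + 1) + (l k + m k) ≤ W k)
    (hb1 : ∀ k y, 1 ≤ (Cb y).width k) (ys : List IB) :
    LogspaceUniform fun k => (CompiledGames.proverCircuit (h k) (l k) (m k) (hW k)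
      (Cψ.circuit k) (hψ k) (Cp.circuit k) (hp k) (hmp k) (Cu.circuit k) (hu k)
      (fun y => (Cb y).circuit k) (hb k) (hb1 k) ys).map Gate.code := by
  have hd := hl.add (LogspaceComputable.const 1)
  simp only [CompiledGames.proverCircuit, List.map_append]
  exact (LogspaceUniform.moveGates hh hl _).append
    ((LogspaceUniform.relocate Cψ hh hd (hl.add hm) hψ).append
    ((LogspaceUniform.measureGates Cp hm (hh.add hl) hd hm ((hd.add hh).add hl) hmp hp _
      (fun _ _ => rfl) _).append
    ((LogspaceUniform.relocate Cu (LogspaceComputable.const 0) hd (LogspaceComputable.const 0)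
      hu).append (LogspaceUniform.bobGates Cb hh hl hm hb hb1 ys))))

end Uniform

/-! ### Bob's moments do not depend on the encrypted question -/

variable {IA IB : Type*} [Fintype IA] [Fintype IB] {n : ℕ} {G : CompiledGame IA IB n}

/-- The adversary makes no queries, so its acceptance probability depends on the key only through
the challenge. -/
theorem Strategy.exists_adversary (S : Strategy G) (ys : List IB) :
    ∃ A : G.qhe.Adversary, ∀ k, ∀ c ∈ G.challenges k, ∀ sk, A.accept k sk c =
      ∑ α, ((star (S.post k c α) ⬝ᵥ S.post k c α).re -
        (star (S.post k c α) ⬝ᵥ (obsProd (S.obs k) ys *ᵥ S.post k c α)).re) / 2 := by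
  obtain ⟨Cψ, hCψ⟩ := S.ψ_qpt
  obtain ⟨Cp, hCp⟩ := S.P_qpt
  obtain ⟨Cu, hCu⟩ := S.U_qpt
  choose Cb hCb using S.B_qpt
  set l := G.qhe.ciphLen
  set h := S.dim
  set m := S.ansLen
  -- A sum rather than a maximum: it has room for every relocated circuit and is logspace computable
  -- by closure under addition.
  set W : ℕ → ℕ := fun k => l k + 1 + (h k + l k + m k) +
    (Cψ.width k + Cp.width k + Cu.width k + ∑ y, (Cb y).width k) with hWdef
  have hwb : ∀ k y, (Cb y).width k ≤ ∑ y, (Cb y).width k := fun k y =>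
    Finset.single_le_sum (f := fun y => (Cb y).width k) (fun _ _ => Nat.zero_le _)
      (Finset.mem_univ y)
  have hl : LogspaceComputable l := G.qhe.ciphLen_logspace
  have hh : LogspaceComputable h := S.dim_logspace
  have hm : LogspaceComputable m := S.ansLen_logspace
  have hWlog : LogspaceComputable W :=
    ((hl.add (LogspaceComputable.const 1)).add ((hh.add hl).add hm)).add
      (((Cψ.width_logspace.add Cp.width_logspace).add Cu.width_logspace).add
        (LogspaceComputable.sum _ fun y => (Cb y).width_logspace))
  have eW : ∀ k, W k = l k + 1 + (h k + l k + m k) +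
    (Cψ.width k + Cp.width k + Cu.width k + ∑ y, (Cb y).width k) := fun _ => rfl
  have hW : ∀ k, l k + 1 + h k + l k + m k ≤ W k := fun k => by rw [eW]; omega
  have hψ : ∀ k, Cψ.width k + (l k + 1) + (l k + m k) ≤ W k := fun k => by rw [eW]; omega
  have hp : ∀ k, Cp.width k + (l k + 1) + m k ≤ W k := fun k => by rw [eW]; omega
  have hu : ∀ k, Cu.width k + (l k + 1) + 0 ≤ W k := fun k => by rw [eW]; omega
  have hb : ∀ k y, (Cb y).width k + (l k + 1) + (l k + m k) ≤ W k := fun k y => by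
    have := hwb k y
    rw [eW]; omega
  let C : ∀ k, Circuit (W k) := fun k => proverCircuit (h k) (l k) (m k) (hW k) (Cψ.circuit k)
    (hψ k) (Cp.circuit k) (hp k) (hCp k).2.1 (Cu.circuit k) (hu k) (fun y => (Cb y).circuit k)
    (hb k) (fun y => (hCb y k).2.1) ys
  have hunif : LogspaceUniform fun k => (C k).map Gate.code :=
    LogspaceUniform.proverCircuit hh hl hm hW Cψ Cp Cu Cb hψ hp (fun k => (hCp k).2.1) hu hb
      (fun k y => (hCb y k).2.1) ys
  refine ⟨⟨W, fun k => (C k).map QHE.OGate.gate, hWlog, ?_, fun k => ?_, fun k => ?_⟩, ?_⟩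
  · simp only [List.map_map]
    exact hunif
  · have := hW k
    change l k ≤ W k
    omega
  · have := hW k
    omega
  · intro k c hc sk
    have main := proverCircuit_mulVec (hW k) (Cψ.circuit k) (hψ k) (Cp.circuit k) (hp k)
      (hCp k).2.1 (Cu.circuit k) (hu k) (fun y => (Cb y).circuit k) (hb k)
      (fun y => (hCb y k).2.1) ys (hCψ k).1 ((Nat.le_add_right _ _).trans (hCp k).1)
      ((Nat.le_add_right _ _).trans (hCu k).1) (fun y => by have := (hCb y k).1; omega) c (S.ψ k)
      (S.P k c) (S.U k c) (S.B k) (hCψ k).2 (S.P_pvm k c hc)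
      (fun α => (hCp k).2.2 c hc α)
      (fun α => by
        have := (hCu k).2 (Fin.append c α) ⟨c, hc, α, rfl⟩
        simpa only [Fin.append_left, Fin.append_right] using this)
      (S.B_pvm k) (fun y α => (hCb y k).2.2 Fin.elim0 (Set.mem_univ _) α)
    have hs : Matrix.single (c.resize (W k)) (c.resize (W k)) (1 : ℂ) =
        Matrix.vecMulVec (Pi.single (c.resize (W k)) 1) (star (Pi.single (c.resize (W k)) 1)) := by
      ext z z'
      simp [Matrix.single_apply, Matrix.vecMulVec_apply, Pi.single_apply, eq_comm, ← ite_and,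
        and_comm]
    simp only [QHE.Adversary.accept]
    rw [hs, foldl_step_gates, sum_accepting (hW k) c _ _ main, Complex.re_sum]
    refine Finset.sum_congr rfl fun α _ => ?_
    exact re_inner_half_sub _ (obsProd_unitary (S.B_pvm k) ys) (S.post k c α)

theorem Strategy.expect_re (S : Strategy G) (k : ℕ) (x : IA) (f : Bool → ℂ)
    (M : Matrix (Bits (S.dim k)) (Bits (S.dim k)) ℂ) :
    (S.expect k x f M).re = ∑ sk, G.qhe.genProb k sk *
      ∑ c, G.qhe.encProb k sk (G.encode x) c * ∑ α : Bits (S.ansLen k),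
        (f (G.qhe.dec k sk (List.ofFn α)) * (star (S.post k c α) ⬝ᵥ (M *ᵥ S.post k c α))).re := by
  simp only [Strategy.expect, Complex.re_sum, Complex.re_ofReal_mul]

/-- The acceptance probability is `(1 - moment) / 2`, so the moments of two questions differ by
twice the distinguishing advantage. -/
theorem Strategy.negligible_moment (S : Strategy G) (hsecure : G.qhe.CPASecure) (ys : List IB)
    (x x' : IA) : Negligible fun k => |(S.expect k x (fun _ => 1) (obsProd (S.obs k) ys)).re -
      (S.expect k x' (fun _ => 1) (obsProd (S.obs k) ys)).re| := by
  obtain ⟨A, hA⟩ := S.exists_adversary ys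
  have key : ∀ k x, A.winProb k (G.encode x) =
      (1 - (S.expect k x (fun _ => 1) (obsProd (S.obs k) ys)).re) / 2 := by
    intro k x
    have h1 : (S.expect k x (fun _ => 1) 1).re = 1 := by rw [S.expect_one, Complex.one_re]
    rw [← h1, S.expect_re, S.expect_re, QHE.Adversary.winProb, ← Finset.sum_sub_distrib,
      Finset.sum_div]
    refine Finset.sum_congr rfl fun sk _ => ?_
    rw [← mul_sub, mul_div_assoc, ← Finset.sum_sub_distrib, Finset.sum_div]
    -- The strategy is constrained only on challenges of positive probability; the others carry
    -- weight 0.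
    rcases (PPT.prob_nonneg G.qhe.gen k Fin.elim0 sk).eq_or_lt with h | h
    · rw [QHE.genProb, ← h, zero_mul, zero_mul]
    congr 1
    refine Finset.sum_congr rfl fun c _ => ?_
    rw [← mul_sub, mul_div_assoc]
    rcases (PPT.prob_nonneg G.qhe.enc k (Fin.append sk (G.encode x)) c).eq_or_lt with h' | h'
    · rw [QHE.encProb, ← h', zero_mul, zero_mul]
    rw [hA k c ⟨sk, x, h, h'⟩ sk, ← Finset.sum_sub_distrib, Finset.sum_div]
    simp only [one_mul, Matrix.one_mulVec]
  have h := (hsecure A (G.encode x) (G.encode x')).const_mul 2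
  refine h.congr fun k => ?_
  rw [key, key, ← abs_two, ← abs_mul, abs_two, ← abs_neg]
  congr 1
  ring

end CompiledGames

namespace CompiledGames

/-! ### Identities and functionals on the scenario algebra -/

section ScenarioAlgebra

variable {IA IB : Type*}

theorem sum_obsB_sq [Fintype IB] (γ : IB → ℝ) :
    (∑ y, (γ y : ℂ) • (obsB y : ScenarioAlgebra IA IB)) ^ 2 =
    ∑ y, ∑ v, ((γ y * γ v : ℝ) : ℂ) • (obsB y * obsB v) := by
  rw [sq, Finset.sum_mul_sum]
  refine Finset.sum_congr rfl fun y _ => Finset.sum_congr rfl fun v _ => ?_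
  rw [smul_mul_smul_comm]
  push_cast
  rfl

theorem obsA_mul_self (x : IA) : (obsA x : ScenarioAlgebra IA IB) * obsA x = 1 := by
  rw [obsA, ← map_mul, Prod.mk_mul_mk, FreeZ2.gen_mul_self, one_mul]
  exact map_one _

theorem obsB_mul_obsA (x : IA) (y : IB) :
    (obsB y : ScenarioAlgebra IA IB) * obsA x = obsA x * obsB y := by
  rw [obsA, obsB, ← map_mul, ← map_mul, Prod.mk_mul_mk, Prod.mk_mul_mk]
  simp

theorem alice_sq [Fintype IB] (x : IA) (γ : IB → ℝ) :
    (obsA x - ∑ y, (γ y : ℂ) • (obsB y : ScenarioAlgebra IA IB)) ^ 2 =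
      1 - (2 : ℂ) • (∑ y, (γ y : ℂ) • (obsA x * obsB y)) +
        (∑ y, (γ y : ℂ) • (obsB y : ScenarioAlgebra IA IB)) ^ 2 := by
  have h1 : obsA x * ∑ y, (γ y : ℂ) • (obsB y : ScenarioAlgebra IA IB) =
      ∑ y, (γ y : ℂ) • (obsA x * obsB y) := by
    rw [Finset.mul_sum]
    exact Finset.sum_congr rfl fun y _ => mul_smul_comm _ _ _
  have h2 : (∑ y, (γ y : ℂ) • (obsB y : ScenarioAlgebra IA IB)) * obsA x =
      ∑ y, (γ y : ℂ) • (obsA x * obsB y) := by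
    rw [Finset.sum_mul]
    exact Finset.sum_congr rfl fun y _ => by rw [smul_mul_assoc, obsB_mul_obsA]
  rw [sq, sub_mul, mul_sub, mul_sub, obsA_mul_self, h1, h2, ← sq, two_smul]
  abel

theorem projA_mul_projB (x : IA) (y : IB) (a b : Bool) :
    (projA x a * projB y b : ScenarioAlgebra IA IB) = (1 / 4 : ℂ) •
      (1 + sgn a • obsA x + sgn b • obsB y + (sgn a * sgn b) • (obsA x * obsB y)) := by
  rw [projA, projB, smul_mul_smul_comm, add_mul, mul_add, mul_add, one_mul, one_mul, mul_one,
    smul_mul_smul_comm, show (1 / 2 * (1 / 2) : ℂ) = 1 / 4 by norm_num]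
  congr 1
  abel

/-- The linear functional with given values on the words of length one that vanishes on all other
words. -/
noncomputable def linearPart (a : IA → ℂ) (b : IB → ℂ) : ScenarioAlgebra IA IB →ₗ[ℂ] ℂ :=
  Finsupp.linearCombination ℂ (fun g : FreeZ2 IA × FreeZ2 IB =>
    match g.1.letters, g.2.letters with
    | [x], [] => a x
    | [], [y] => b y
    | _, _ => 0) ∘ₗ (MonoidAlgebra.coeffLinearEquiv ℂ).toLinearMap

variable (a : IA → ℂ) (b : IB → ℂ)

theorem linearPart_of (g : FreeZ2 IA × FreeZ2 IB) :
    linearPart a b (MonoidAlgebra.of ℂ _ g) = match g.1.letters, g.2.letters with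
    | [x], [] => a x
    | [], [y] => b y
    | _, _ => 0 := by
  simp [linearPart, MonoidAlgebra.of]

theorem linearPart_one : linearPart a b 1 = 0 := by
  rw [← map_one (MonoidAlgebra.of ℂ _), linearPart_of]
  simp [FreeZ2.letters_one]

theorem linearPart_obsA (x : IA) : linearPart a b (obsA x) = a x := by
  rw [obsA, linearPart_of]
  simp [FreeZ2.letters_one, FreeZ2.letters_gen]

theorem linearPart_obsB (y : IB) : linearPart a b (obsB y) = b y := by
  rw [obsB, linearPart_of]
  simp [FreeZ2.letters_one, FreeZ2.letters_gen]

theorem linearPart_ab (x : IA) (y : IB) : linearPart a b (obsA x * obsB y) = 0 := by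
  rw [obsA, obsB, ← map_mul, linearPart_of, Prod.mk_mul_mk]
  simp [FreeZ2.letters_gen]

theorem linearPart_bb (y v : IB) : linearPart a b (obsB y * obsB v) = 0 := by
  rw [obsB, obsB, ← map_mul, linearPart_of, Prod.mk_mul_mk]
  by_cases h : y = v
  · subst h
    simp [FreeZ2.letters_one, FreeZ2.gen_mul_self]
  · simp [FreeZ2.letters_one, FreeZ2.letters_gen_mul h]

/-- After `a_x² = 1`, a nice square only contains words of length 0 and 2, so values on single
letters can be chosen freely. -/
theorem linearPart_niceSquare [Fintype IB] {q : ScenarioAlgebra IA IB} (hq : IsNiceSquare q) :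
    linearPart a b q = 0 := by
  have hB : ∀ γ : IB → ℝ, linearPart a b ((∑ y, (γ y : ℂ) • obsB y) ^ 2) = 0 := fun γ => by
    rw [sum_obsB_sq]
    simp [linearPart_bb]
  cases hq with
  | bob γ => exact hB γ
  | alice x γ =>
    rw [alice_sq, map_add, hB, map_sub, linearPart_one]
    simp [linearPart_ab]

end ScenarioAlgebra

variable {IA IB : Type*} [Fintype IA] [Fintype IB] {n : ℕ} {G : CompiledGame IA IB n}

/-! ### Properties of the expectation functional -/

section Expect

variable (S : Strategy G) (k : ℕ) (x : IA)

theorem Strategy.expect_add_right (f : Bool → ℂ)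
    (M N : Matrix (Bits (S.dim k)) (Bits (S.dim k)) ℂ) :
    S.expect k x f (M + N) = S.expect k x f M + S.expect k x f N := by
  simp only [Strategy.expect, Matrix.add_mulVec, dotProduct_add, mul_add, Finset.sum_add_distrib]

theorem Strategy.expect_smul_right (f : Bool → ℂ) (c : ℂ)
    (M : Matrix (Bits (S.dim k)) (Bits (S.dim k)) ℂ) :
    S.expect k x f (c • M) = c * S.expect k x f M := by
  simp only [Strategy.expect, Matrix.smul_mulVec, dotProduct_smul, smul_eq_mul, Finset.mul_sum]
  refine Finset.sum_congr rfl fun _ _ => Finset.sum_congr rfl fun _ _ =>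
    Finset.sum_congr rfl fun _ _ => by ring

theorem Strategy.expect_add_left (f g : Bool → ℂ) (M : Matrix (Bits (S.dim k)) (Bits (S.dim k)) ℂ) :
    S.expect k x (f + g) M = S.expect k x f M + S.expect k x g M := by
  simp only [Strategy.expect, Pi.add_apply, add_mul, mul_add, Finset.sum_add_distrib]

theorem Strategy.expect_smul_left (c : ℂ) (f : Bool → ℂ)
    (M : Matrix (Bits (S.dim k)) (Bits (S.dim k)) ℂ) :
    S.expect k x (c • f) M = c * S.expect k x f M := by
  simp only [Strategy.expect, Pi.smul_apply, smul_eq_mul, Finset.mul_sum]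
  refine Finset.sum_congr rfl fun _ _ => Finset.sum_congr rfl fun _ _ =>
    Finset.sum_congr rfl fun _ _ => by ring

/-- `expect` as a linear functional of the observable. -/
noncomputable def Strategy.expectHom (f : Bool → ℂ) :
    Matrix (Bits (S.dim k)) (Bits (S.dim k)) ℂ →ₗ[ℂ] ℂ where
  toFun := S.expect k x f
  map_add' := S.expect_add_right k x f
  map_smul' := S.expect_smul_right k x f

theorem Strategy.expect_sum_smul {ι : Type*} [Fintype ι] (f : Bool → ℂ) (c : ι → ℂ)
    (M : ι → Matrix (Bits (S.dim k)) (Bits (S.dim k)) ℂ) :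
    S.expect k x f (∑ i, c i • M i) = ∑ i, c i * S.expect k x f (M i) := by
  change S.expectHom k x f _ = _
  rw [map_sum]
  exact Finset.sum_congr rfl fun i _ => map_smul _ _ _

theorem dotProduct_mulVec_im {ι : Type*} [Fintype ι] {M : Matrix ι ι ℂ} (hM : Mᴴ = M)
    (v : ι → ℂ) : (star v ⬝ᵥ (M *ᵥ v)).im = 0 := by
  rw [← Complex.conj_eq_iff_im]
  change star _ = _
  rw [← Matrix.star_dotProduct, Matrix.star_mulVec, hM, Matrix.dotProduct_mulVec]

theorem Strategy.expect_im {f : Bool → ℂ} (hf : ∀ b, (f b).im = 0)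
    {M : Matrix (Bits (S.dim k)) (Bits (S.dim k)) ℂ} (hM : Mᴴ = M) :
    (S.expect k x f M).im = 0 := by
  simp only [Strategy.expect, Complex.im_sum, Complex.im_ofReal_mul]
  refine Finset.sum_eq_zero fun _ _ => mul_eq_zero_of_right _ <| Finset.sum_eq_zero fun _ _ =>
    mul_eq_zero_of_right _ <| Finset.sum_eq_zero fun _ _ => ?_
  rw [Complex.mul_im, hf, dotProduct_mulVec_im hM]
  simp

theorem sgn_im (b : Bool) : (sgn b).im = 0 := by cases b <;> simp [sgn]

theorem re_self_inner_nonneg {ι : Type*} [Fintype ι] (v : ι → ℂ) : 0 ≤ (star v ⬝ᵥ v).re :=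
  (Complex.le_def.1 (dotProduct_star_self_nonneg v)).1

theorem Strategy.expect_mul_self_nonneg {M : Matrix (Bits (S.dim k)) (Bits (S.dim k)) ℂ}
    (hM : Mᴴ = M) : 0 ≤ (S.expect k x (fun _ => 1) (M * M)).re := by
  rw [S.expect_re]
  refine Finset.sum_nonneg fun sk _ => mul_nonneg (PPT.prob_nonneg _ _ _ _) <|
    Finset.sum_nonneg fun c _ => mul_nonneg (PPT.prob_nonneg _ _ _ _) <|
    Finset.sum_nonneg fun α _ => ?_
  have : star (S.post k c α) ⬝ᵥ ((M * M) *ᵥ S.post k c α) =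
      star (M *ᵥ S.post k c α) ⬝ᵥ (M *ᵥ S.post k c α) := by
    rw [Matrix.star_mulVec, hM, ← Matrix.dotProduct_mulVec, Matrix.mulVec_mulVec]
  rw [one_mul, this]
  exact re_self_inner_nonneg _

/-- `(a_x - T)²` is positive if the moments of `T` are taken at the encrypted question `x`. -/
theorem Strategy.expect_alice_nonneg {T : Matrix (Bits (S.dim k)) (Bits (S.dim k)) ℂ}
    (hT : Tᴴ = T) :
    0 ≤ 1 - 2 * (S.expect k x sgn T).re + (S.expect k x (fun _ => 1) (T * T)).re := by
  have h1 : (S.expect k x (fun _ => 1) 1).re = 1 := by rw [S.expect_one, Complex.one_re]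
  rw [← h1, S.expect_re, S.expect_re, S.expect_re, Finset.mul_sum, ← Finset.sum_sub_distrib,
    ← Finset.sum_add_distrib]
  refine Finset.sum_nonneg fun sk _ => ?_
  rw [mul_left_comm, ← mul_sub, ← mul_add, Finset.mul_sum, ← Finset.sum_sub_distrib,
    ← Finset.sum_add_distrib]
  refine mul_nonneg (PPT.prob_nonneg _ _ _ _) <| Finset.sum_nonneg fun c _ => ?_
  rw [mul_left_comm, ← mul_sub, ← mul_add, Finset.mul_sum, ← Finset.sum_sub_distrib,
    ← Finset.sum_add_distrib]
  refine mul_nonneg (PPT.prob_nonneg _ _ _ _) <| Finset.sum_nonneg fun α _ => ?_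
  set v := S.post k c α
  have h2 : star v ⬝ᵥ ((T * T) *ᵥ v) = star (T *ᵥ v) ⬝ᵥ (T *ᵥ v) := by
    rw [Matrix.star_mulVec, hT, ← Matrix.dotProduct_mulVec, Matrix.mulVec_mulVec]
  have h3 : star (T *ᵥ v) ⬝ᵥ v = star v ⬝ᵥ (T *ᵥ v) := by
    rw [Matrix.star_mulVec, hT, ← Matrix.dotProduct_mulVec]
  rw [one_mul, one_mul, Matrix.one_mulVec, h2]
  -- The decrypted bit decides which of `‖v - T v‖²` and `‖v + T v‖²` is expanded.
  cases G.qhe.dec k sk (List.ofFn α)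
  · have := re_self_inner_nonneg (v - T *ᵥ v)
    rw [star_sub, sub_dotProduct, dotProduct_sub, dotProduct_sub, h3] at this
    simp only [Complex.sub_re, sgn, Bool.false_eq_true, if_false, one_mul] at this ⊢
    linarith
  · have := re_self_inner_nonneg (v + T *ᵥ v)
    rw [star_add, add_dotProduct, dotProduct_add, dotProduct_add, h3] at this
    simp only [Complex.add_re, sgn, if_true, neg_mul, one_mul, Complex.neg_re] at this ⊢
    linarith

/-- A linear combination of Bob's observables. -/
noncomputable def Strategy.obsSum (γ : IB → ℝ) : Matrix (Bits (S.dim k)) (Bits (S.dim k)) ℂ :=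
  ∑ y, (γ y : ℂ) • S.obs k y

theorem Strategy.obsSum_conjTranspose (γ : IB → ℝ) : (S.obsSum k γ)ᴴ = S.obsSum k γ := by
  rw [Strategy.obsSum, Matrix.conjTranspose_sum]
  refine Finset.sum_congr rfl fun y _ => ?_
  rw [Matrix.conjTranspose_smul, Strategy.obs, (S.B_pvm k y).conjTranspose_obs]
  simp

theorem Strategy.expect_obsSum_mul_self (f : Bool → ℂ) (γ : IB → ℝ) :
    S.expect k x f (S.obsSum k γ * S.obsSum k γ) =
      ∑ y, ∑ v, ((γ y * γ v : ℝ) : ℂ) * S.expect k x f (S.obs k y * S.obs k v) := by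
  have : S.obsSum k γ * S.obsSum k γ =
      ∑ y, (γ y : ℂ) • ∑ v, (γ v : ℂ) • (S.obs k y * S.obs k v) := by
    simp only [Strategy.obsSum, Finset.sum_mul, Finset.mul_sum, Matrix.smul_mul, Matrix.mul_smul,
      Finset.smul_sum]
    refine Finset.sum_comm.trans ?_
    refine Finset.sum_congr rfl fun y _ => Finset.sum_congr rfl fun v _ => ?_
    rw [smul_comm]
  rw [this, S.expect_sum_smul]
  refine Finset.sum_congr rfl fun y _ => ?_
  rw [S.expect_sum_smul, Finset.mul_sum]
  refine Finset.sum_congr rfl fun v _ => ?_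
  push_cast
  ring

end Expect

/-! ### The pseudo-expectation of nice squares -/

section NiceSquares

variable (S : Strategy G) (μ : IA → ℝ) (k : ℕ)

theorem Strategy.pseudoExp_bob_sq (hμ : ∑ x, μ x = 1) (γ : IB → ℝ) :
    S.pseudoExp μ k ((∑ y, (γ y : ℂ) • obsB y) ^ 2) =
      ∑ x, (μ x : ℂ) * S.expect k x (fun _ => 1) (S.obsSum k γ * S.obsSum k γ) := by
  simp only [sum_obsB_sq, map_sum, map_smul, S.pseudoExp_bb μ k hμ, Strategy.corrBB,
    S.expect_obsSum_mul_self, smul_eq_mul, Finset.mul_sum]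
  symm
  rw [Finset.sum_comm]
  refine Finset.sum_congr rfl fun y _ => ?_
  rw [Finset.sum_comm]
  exact Finset.sum_congr rfl fun v _ => Finset.sum_congr rfl fun x _ => mul_left_comm _ _ _

/-- The mixed term is taken at `x`, but the quadratic term is averaged over `μ`. This mismatch is
the only obstacle to exact positivity. -/
theorem Strategy.pseudoExp_alice_sq (hμ : ∑ x, μ x = 1) (x : IA) (γ : IB → ℝ) :
    S.pseudoExp μ k ((obsA x - ∑ y, (γ y : ℂ) • obsB y) ^ 2) =
      1 - 2 * S.expect k x sgn (S.obsSum k γ) +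
      ∑ x, (μ x : ℂ) * S.expect k x (fun _ => 1) (S.obsSum k γ * S.obsSum k γ) := by
  rw [alice_sq, map_add, map_sub, S.pseudoExp_one, S.pseudoExp_bob_sq μ k hμ, map_smul, map_sum,
    Strategy.obsSum, S.expect_sum_smul, smul_eq_mul]
  simp only [map_smul, S.pseudoExp_ab, smul_eq_mul, Strategy.corrAB]

theorem Strategy.bobMoment_im (γ : IB → ℝ) : (∑ x, (μ x : ℂ) *
    S.expect k x (fun _ => 1) (S.obsSum k γ * S.obsSum k γ)).im = 0 := by
  rw [Complex.im_sum]
  refine Finset.sum_eq_zero fun x _ => ?_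
  rw [Complex.im_ofReal_mul, S.expect_im k x (fun _ => Complex.one_im), mul_zero]
  rw [Matrix.conjTranspose_mul, S.obsSum_conjTranspose]

theorem Strategy.pseudoExp_bob_nonneg (hμ0 : ∀ x, 0 ≤ μ x) (hμ : ∑ x, μ x = 1) (γ : IB → ℝ) :
    0 ≤ S.pseudoExp μ k ((∑ y, (γ y : ℂ) • obsB y) ^ 2) := by
  rw [S.pseudoExp_bob_sq μ k hμ, Complex.le_def, S.bobMoment_im, Complex.re_sum]
  refine ⟨Finset.sum_nonneg fun x _ => ?_, rfl⟩
  rw [Complex.re_ofReal_mul]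
  exact mul_nonneg (hμ0 x) (S.expect_mul_self_nonneg k x (S.obsSum_conjTranspose k γ))

/-! ### Error bounds from CPA security -/

/-- The variation of Bob's moment for the questions in `ys` with the encrypted question. -/
noncomputable def Strategy.variation (ys : List IB) (k : ℕ) : ℝ :=
  ∑ x, ∑ x', |(S.expect k x (fun _ => 1) (obsProd (S.obs k) ys)).re -
    (S.expect k x' (fun _ => 1) (obsProd (S.obs k) ys)).re|

theorem Negligible.sum {ι : Type*} (s : Finset ι) {η : ι → ℕ → ℝ}
    (h : ∀ i, Negligible (η i)) : Negligible fun k => ∑ i ∈ s, η i k := by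
  classical
  induction s using Finset.induction_on with
  | empty => exact Asymptotics.superpolynomialDecay_zero _ _
  | insert i s hi ih =>
    simp only [Finset.sum_insert hi]
    exact Asymptotics.SuperpolynomialDecay.add (h i) ih

theorem Negligible.abs {η : ℕ → ℝ} (h : Negligible η) : Negligible fun k => |η k| :=
  Asymptotics.SuperpolynomialDecay.trans_abs_le h fun k => by rw [abs_abs]

theorem Strategy.negligible_variation (hsecure : G.qhe.CPASecure) (ys : List IB) :
    Negligible (S.variation ys) :=
  Negligible.sum _ fun x => Negligible.sum _ fun x' => S.negligible_moment hsecure ys x x'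

theorem Strategy.abs_sub_le_variation (ys : List IB) (x x' : IA) :
    |(S.expect k x (fun _ => 1) (obsProd (S.obs k) ys)).re -
      (S.expect k x' (fun _ => 1) (obsProd (S.obs k) ys)).re| ≤ S.variation ys k :=
  (Finset.single_le_sum (f := fun x' => |(S.expect k x (fun _ => 1) (obsProd (S.obs k) ys)).re -
      (S.expect k x' (fun _ => 1) (obsProd (S.obs k) ys)).re|) (fun _ _ => abs_nonneg _)
      (Finset.mem_univ x')).trans
    (Finset.single_le_sum (f := fun x => ∑ x', |(S.expect k x (fun _ => 1)
      (obsProd (S.obs k) ys)).re - (S.expect k x' (fun _ => 1) (obsProd (S.obs k) ys)).re|)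
      (fun _ _ => Finset.sum_nonneg fun _ _ => abs_nonneg _) (Finset.mem_univ x))

theorem Strategy.abs_sub_average_le_variation (hμ0 : ∀ x, 0 ≤ μ x) (hμ : ∑ x, μ x = 1)
    (ys : List IB) (x : IA) :
    |(S.expect k x (fun _ => 1) (obsProd (S.obs k) ys)).re -
      ∑ x', μ x' * (S.expect k x' (fun _ => 1) (obsProd (S.obs k) ys)).re| ≤
        S.variation ys k := by
  set e := fun x => (S.expect k x (fun _ => 1) (obsProd (S.obs k) ys)).re
  have h1 : e x - ∑ x', μ x' * e x' = ∑ x', μ x' * (e x - e x') := by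
    simp only [mul_sub, Finset.sum_sub_distrib]
    rw [← Finset.sum_mul, hμ, one_mul]
  calc |e x - ∑ x', μ x' * e x'| ≤ ∑ x', |μ x' * (e x - e x')| := by
        rw [h1]; exact Finset.abs_sum_le_sum_abs _ _
    _ ≤ ∑ x', μ x' * S.variation ys k := Finset.sum_le_sum fun x' _ => by
        rw [abs_mul, abs_of_nonneg (hμ0 x')]
        exact mul_le_mul_of_nonneg_left (S.abs_sub_le_variation k ys x x') (hμ0 x')
    _ = S.variation ys k := by rw [← Finset.sum_mul, hμ, one_mul]

/-- Replacing the averaged moment of `T²` by the one at `x` costs at most the weighted variations.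
Real parts suffice, because the moment of `T²` is real even though single products `B_y B_v` may
have complex moments. -/
theorem Strategy.pseudoExp_alice_ge (hμ0 : ∀ x, 0 ≤ μ x) (hμ : ∑ x, μ x = 1) (x : IA)
    (γ : IB → ℝ) :
    -((∑ y, ∑ v, |γ y * γ v| * S.variation [v, y] k : ℝ) : ℂ) ≤
      S.pseudoExp μ k ((obsA x - ∑ y, (γ y : ℂ) • obsB y) ^ 2) := by
  have hT := S.obsSum_conjTranspose k γ
  -- The list is reversed because its head acts first.
  have hprod : ∀ y v, S.obs k y * S.obs k v = obsProd (S.obs k) [v, y] := fun y v => by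
    simp [obsProd]
  have hre : ∀ x, (S.expect k x (fun _ => 1) (S.obsSum k γ * S.obsSum k γ)).re =
      ∑ y, ∑ v, γ y * γ v * (S.expect k x (fun _ => 1) (obsProd (S.obs k) [v, y])).re := by
    intro x
    rw [S.expect_obsSum_mul_self, Complex.re_sum]
    refine Finset.sum_congr rfl fun y _ => ?_
    rw [Complex.re_sum]
    refine Finset.sum_congr rfl fun v _ => ?_
    rw [Complex.re_ofReal_mul, hprod]
  rw [S.pseudoExp_alice_sq μ k hμ, ← Complex.ofReal_neg, Complex.le_def]
  constructor
  · have h1 := S.expect_alice_nonneg k x hT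
    have h2 : (S.expect k x (fun _ => 1) (S.obsSum k γ * S.obsSum k γ)).re -
        ∑ x', μ x' * (S.expect k x' (fun _ => 1) (S.obsSum k γ * S.obsSum k γ)).re ≤
        ∑ y, ∑ v, |γ y * γ v| * S.variation [v, y] k := by
      have h3 : ∑ x', μ x' * (S.expect k x' (fun _ => 1) (S.obsSum k γ * S.obsSum k γ)).re =
          ∑ y, ∑ v, γ y * γ v *
            ∑ x', μ x' * (S.expect k x' (fun _ => 1) (obsProd (S.obs k) [v, y])).re := by
        simp only [hre, Finset.mul_sum]
        rw [Finset.sum_comm]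
        refine Finset.sum_congr rfl fun y _ => ?_
        rw [Finset.sum_comm]
        exact Finset.sum_congr rfl fun v _ => Finset.sum_congr rfl fun x _ => mul_left_comm _ _ _
      rw [h3, hre, ← Finset.sum_sub_distrib]
      refine Finset.sum_le_sum fun y _ => ?_
      rw [← Finset.sum_sub_distrib]
      refine Finset.sum_le_sum fun v _ => ?_
      rw [← mul_sub]
      refine (le_abs_self _).trans ?_
      rw [abs_mul]
      exact mul_le_mul_of_nonneg_left (S.abs_sub_average_le_variation μ k hμ0 hμ [v, y] x)
        (abs_nonneg _)
    simp only [Complex.ofReal_re, Complex.add_re, Complex.sub_re, Complex.one_re, Complex.re_sum,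
      Complex.mul_re, Complex.re_ofNat, Complex.im_ofNat, Complex.ofReal_im, zero_mul, sub_zero]
      at h1 h2 ⊢
    linarith
  -- The order on `ℂ` also demands equal imaginary parts; both sides are real since `T` is
  -- self-adjoint.
  · rw [Complex.add_im, S.bobMoment_im, Complex.sub_im, Complex.mul_im,
      S.expect_im k x sgn_im hT]
    simp

end NiceSquares

/-! ### Comparison of the bias with the pseudo-expectation -/

section Bias

variable (S : Strategy G) (μ : IA → ℝ) (k : ℕ)

theorem Strategy.pseudoExp_obsA (x : IA) : S.pseudoExp μ k (obsA x) = 0 := by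
  rw [obsA, S.pseudoExp_of]
  simp [Strategy.wordValue, FreeZ2.letters_one, FreeZ2.letters_gen]

theorem Strategy.pseudoExp_obsB (y : IB) : S.pseudoExp μ k (obsB y) = 0 := by
  rw [obsB, S.pseudoExp_of]
  simp [Strategy.wordValue, FreeZ2.letters_one, FreeZ2.letters_gen]

/-- The pseudo-expectation extended to words of length one. -/
noncomputable def Strategy.extendedExp : ScenarioAlgebra IA IB →ₗ[ℂ] ℂ :=
  S.pseudoExp μ k + linearPart (fun x => S.expect k x sgn 1)
    (fun y => ∑ x, (μ x : ℂ) * S.expect k x (fun _ => 1) (S.obs k y))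

theorem Strategy.extendedExp_one : S.extendedExp μ k 1 = 1 := by
  rw [Strategy.extendedExp, LinearMap.add_apply, S.pseudoExp_one, linearPart_one, add_zero]

theorem Strategy.extendedExp_proj (x : IA) (y : IB) (a b : Bool) :
    S.extendedExp μ k (projA x a * projB y b) = (1 / 4) * (1 + sgn a * S.expect k x sgn 1 +
      sgn b * (∑ x, (μ x : ℂ) * S.expect k x (fun _ => 1) (S.obs k y)) +
      sgn a * sgn b * S.corrAB k x y) := by
  rw [projA_mul_projB, map_smul, map_add, map_add, map_add, S.extendedExp_one]
  simp only [Strategy.extendedExp, LinearMap.add_apply, map_smul, S.pseudoExp_obsA,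
    S.pseudoExp_obsB, S.pseudoExp_ab, linearPart_obsA, linearPart_obsB, linearPart_ab, smul_eq_mul,
    zero_add, add_zero]

/-- Compared with `Strategy.extendedExp_proj`, only Bob's marginal differs: it is taken at `x`
instead of averaged over `μ`. -/
theorem Strategy.expect_proj (x : IA) (y : IB) (a b : Bool) :
    S.expect k x (fun a' => if a' = a then 1 else 0) (S.B k y b) =
      (1 / 4) * (1 + sgn a * S.expect k x sgn 1 + sgn b * S.expect k x (fun _ => 1) (S.obs k y) +
        sgn a * sgn b * S.corrAB k x y) := by
  have h1 : (fun a' => if a' = a then 1 else 0 : Bool → ℂ) =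
      (1 / 2 : ℂ) • ((fun _ => 1) + sgn a • sgn) := by
    ext a'
    cases a <;> cases a' <;> norm_num [sgn]
  have h2 : S.B k y b = (1 / 2 : ℂ) • (1 + sgn b • S.obs k y) := by
    have h := (S.B_pvm k y).sum_eq_one
    rw [Fintype.sum_bool] at h
    rw [← h, Strategy.obs]
    cases b <;> simp only [sgn, if_true, Bool.false_eq_true, if_false] <;> module
  rw [h1, h2, S.expect_smul_left, S.expect_smul_right, S.expect_add_right, S.expect_add_left,
    S.expect_add_left, S.expect_smul_right, S.expect_smul_right, S.expect_smul_left,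
    S.expect_smul_left, S.expect_one, Strategy.corrAB]
  ring

theorem Strategy.prob_le (hμ0 : ∀ x, 0 ≤ μ x) (hμ : ∑ x, μ x = 1) (x : IA) (y : IB)
    (a b : Bool) : S.prob k a b x y ≤
      (S.extendedExp μ k (projA x a * projB y b)).re + (1 / 4) * S.variation [y] k := by
  have h := S.abs_sub_average_le_variation μ k hμ0 hμ [y] x
  simp only [obsProd, Matrix.one_mul] at h
  rw [Strategy.prob, S.expect_proj, S.extendedExp_proj, ← sub_le_iff_le_add', ← Complex.sub_re,
    ← mul_sub, show (1 / 4 : ℂ) = ((1 / 4 : ℝ) : ℂ) by push_cast; rfl, Complex.re_ofReal_mul]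
  refine mul_le_mul_of_nonneg_left ?_ (by norm_num)
  have h2 : (∑ x', μ x' * (S.expect k x' (fun _ => 1) (S.obs k y)).re) =
      (∑ x', (μ x' : ℂ) * S.expect k x' (fun _ => 1) (S.obs k y)).re := by
    simp only [Complex.re_sum, Complex.re_ofReal_mul]
  rw [h2, ← Complex.sub_re] at h
  -- The sign of Bob's marginal depends on `b`, so the two cases use opposite sides of the absolute
  -- value.
  cases b
  · refine le_trans (le_of_eq ?_) ((le_abs_self _).trans h)
    congr 1
    simp only [sgn, Bool.false_eq_true, if_false]
    ring
  · refine le_trans (le_of_eq ?_) ((neg_le_abs _).trans h)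
    rw [← Complex.neg_re]
    congr 1
    simp only [sgn, if_true]
    ring

theorem Strategy.bias_le (hμ0 : ∀ x, 0 ≤ μ x) (hμ : ∑ x, μ x = 1) :
    S.bias k ≤ (S.extendedExp μ k G.game.biasPoly).re + 2 * ∑ x, ∑ y, G.game.π x y *
      ∑ _a : Bool, ∑ _b : Bool, (1 / 4) * S.variation [y] k := by
  have hv : ∀ ys, 0 ≤ S.variation ys k := fun ys =>
    Finset.sum_nonneg fun _ _ => Finset.sum_nonneg fun _ _ => abs_nonneg _
  have h1 : (S.extendedExp μ k G.game.biasPoly).re = 2 * (∑ x, ∑ y, G.game.π x y *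
      ∑ a, ∑ b, if G.game.V x y a b then (S.extendedExp μ k (projA x a * projB y b)).re else 0) -
        1 := by
    rw [Game.biasPoly, map_sub, map_smul, S.extendedExp_one, Game.poly, smul_eq_mul,
      Complex.sub_re, Complex.one_re, ← Complex.ofReal_ofNat, Complex.re_ofReal_mul]
    simp only [map_sum, map_smul, smul_eq_mul, Complex.re_sum, Complex.re_ofReal_mul]
    congr 2
    refine Finset.sum_congr rfl fun x _ => Finset.sum_congr rfl fun y _ => ?_
    congr 1
    refine Finset.sum_congr rfl fun a _ => Finset.sum_congr rfl fun b _ => ?_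
    split_ifs <;> simp
  have h2 : S.winProb k ≤ (∑ x, ∑ y, G.game.π x y *
      ∑ a, ∑ b, if G.game.V x y a b then (S.extendedExp μ k (projA x a * projB y b)).re else 0) +
        ∑ x, ∑ y, G.game.π x y * ∑ _a : Bool, ∑ _b : Bool, (1 / 4) * S.variation [y] k := by
    rw [Strategy.winProb]
    simp only [← Finset.sum_add_distrib, ← mul_add]
    refine Finset.sum_le_sum fun x _ => Finset.sum_le_sum fun y _ =>
      mul_le_mul_of_nonneg_left (Finset.sum_le_sum fun a _ => Finset.sum_le_sum fun b _ => ?_)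
        (G.game.π_nonneg x y)
    split_ifs
    · exact S.prob_le μ k hμ0 hμ x y a b
    -- A losing answer pair is charged the error as well, which is harmless because the variation is
    -- nonnegative.
    · have := hv [y]
      linarith
  rw [Strategy.bias, h1]
  linarith

theorem Strategy.exists_negligible_niceSquare (hsecure : G.qhe.CPASecure) (hμ0 : ∀ x, 0 ≤ μ x)
    (hμ : ∑ x, μ x = 1) {q : ScenarioAlgebra IA IB} (hq : IsNiceSquare q) :
    ∃ η : ℕ → ℝ, Negligible η ∧ ∀ k, -(η k : ℂ) ≤ S.pseudoExp μ k q := by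
  cases hq with
  | bob γ =>
    exact ⟨0, Asymptotics.superpolynomialDecay_zero _ _, fun k => by
      simpa using S.pseudoExp_bob_nonneg μ k hμ0 hμ γ⟩
  | alice x γ =>
    exact ⟨_, Negligible.sum _ fun y => Negligible.sum _ fun v =>
      (S.negligible_variation hsecure [v, y]).const_mul |γ y * γ v|, fun k =>
        S.pseudoExp_alice_ge μ k hμ0 hμ x γ⟩

end Bias

end CompiledGames

/-! ### Assembly of the three claims -/

theorem mainTheorem3 {IA IB : Type*} [Fintype IA] [Fintype IB] {n : ℕ}
    (G : CompiledGame IA IB n) (hcorrect : G.qhe.Correct) (hsecure : G.qhe.CPASecure)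
    (S : Strategy G) (μ : IA → ℝ) (hμ : ∀ x, 0 ≤ μ x) (hμ_sum : ∑ x, μ x = 1) :
    (∀ (γ : IB → ℝ) (k : ℕ),
      0 ≤ S.pseudoExp μ k ((∑ y, (γ y : ℂ) • obsB y) ^ 2)) ∧
    (∀ γ : IA → IB → ℝ, ∃ η : ℕ → ℝ, Negligible η ∧ ∀ (k : ℕ) (x : IA),
      -(η k : ℂ) ≤ S.pseudoExp μ k ((obsA x - ∑ y, (γ x y : ℂ) • obsB y) ^ 2)) ∧
    (∀ β : ℝ, HasNiceSOS ((β : ℂ) • 1 - G.game.biasPoly) →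
      ∃ η : ℕ → ℝ, Negligible η ∧ ∀ k : ℕ, S.bias k ≤ β + η k) := by
  refine ⟨fun γ k => S.pseudoExp_bob_nonneg μ k hμ hμ_sum γ, fun γ => ?_, fun β hβ => ?_⟩
  · choose η hη hle using fun x =>
      S.exists_negligible_niceSquare μ hsecure hμ hμ_sum (IsNiceSquare.alice x (γ x))
    -- Summing absolute values gives one negligible function that serves every question.
    refine ⟨fun k => ∑ x, |η x k|, Negligible.sum _ fun x => (hη x).abs,
      fun k x => le_trans ?_ (hle x k)⟩
    rw [neg_le_neg_iff, Complex.real_le_real]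
    exact (le_abs_self _).trans (Finset.single_le_sum (f := fun x => |η x k|)
      (fun _ _ => abs_nonneg _) (Finset.mem_univ x))
  · obtain ⟨N, c, q, hcq, hsos⟩ := hβ
    choose η hη hle using fun i =>
      S.exists_negligible_niceSquare μ hsecure hμ hμ_sum (hcq i).2
    -- The first term is the error of the squares, the second that of Bob's marginals in the bias.
    refine ⟨fun k => (∑ i, c i * η i k) + 2 * ∑ x, ∑ y, G.game.π x y *
      ∑ _a : Bool, ∑ _b : Bool, (1 / 4) * S.variation [y] k, ?_, fun k => ?_⟩
    · exact Asymptotics.SuperpolynomialDecay.add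
        (Negligible.sum _ fun i => (hη i).const_mul (c i))
        (Asymptotics.SuperpolynomialDecay.const_mul (Negligible.sum _ fun x =>
          Negligible.sum _ fun y => Asymptotics.SuperpolynomialDecay.const_mul
            (Negligible.sum _ fun _ => Negligible.sum _ fun _ =>
              (S.negligible_variation hsecure [y]).const_mul _) _) 2)
    -- The extended functional turns the sum-of-squares identity into a formula for `β` minus the
    -- value on the bias polynomial.
    · have h1 := congrArg (fun p => (S.extendedExp μ k p).re) hsos
      simp only [map_sub, map_smul, map_sum, S.extendedExp_one, smul_eq_mul, mul_one,
        Complex.sub_re, Complex.ofReal_re, Complex.re_sum, Complex.re_ofReal_mul] at h1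
      have h2 : -∑ i, c i * η i k ≤ ∑ i, c i * (S.extendedExp μ k (q i)).re := by
        rw [← Finset.sum_neg_distrib]
        refine Finset.sum_le_sum fun i _ => ?_
        rw [← mul_neg, Strategy.extendedExp, LinearMap.add_apply,
          linearPart_niceSquare _ _ (hcq i).2, add_zero]
        refine mul_le_mul_of_nonneg_left ?_ (hcq i).1
        have := (Complex.le_def.1 (hle i k)).1
        simpa using this
      have h3 := S.bias_le μ k hμ hμ_sum
      linarith
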